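/- Let $(E,\tau_1)$ and $(F,\tau_2)$ be Hausdorff locally convex-solid vector lattices, i.e. real vector lattices with a Hausdorff linear topology that has a base at zero consisting of convex solid sets (such vector lattices are automatically Archimedean). Let $E\overline{\otimes}F$ be the Fremlin tensor product of $E$ and $F$, i.e. the Archimedean vector lattice with a lattice bimorphism $\otimes:E\times F\to E\overline{\otimes}F$ such that every lattice bimorphism $\Phi$ from $E\times F$ into an Archimedean vector lattice $G$ satisfies $\Phi(x,y)=T(x\otimes y)$ for a unique lattice homomorphism $T:E\overline{\otimes}F\to G$. Let $\tau_F$ be the linear topology on $E\overline{\otimes}F$ that has as a base at zero the sets $$\mathrm{Conv}_b\big(\mathrm{Sol}(U\otimes V)\big),$$ where $U\subseteq E$ and $V\subseteq F$ run over the convex solid zero neighbourhoods, $U\otimes V=\{x\otimes y:\ x\in U,\ y\in V\}$, $\mathrm{Sol}(A)=\{z:\ |z|\le|a|\text{ for some }a\in A\}$, and $\mathrm{Conv}_b(A)$ is the convex balanced hull of $A$. Then $(E\overline{\otimes}F,\tau_F)$ is a Hausdorff locally convex-solid vector lattice. -/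

import Mathlib

open Topology
open scoped Pointwise

set_option linter.unusedSectionVars false

universe u v

/-! ### Vector lattices

A (real) vector lattice `E` is given by `[AddCommGroup E] [Lattice E] [IsOrderedAddMonoid E]
[Module ℝ E] [IsOrderedModule ℝ E]`. -/

/-- A vector lattice is Archimedean if `n • x ≤ y` for all `n : ℕ` forces `x ≤ 0`. -/
def IsArchimedeanLattice (G : Type*) [AddCommGroup G] [Lattice G] : Prop :=
  ∀ x y : G, (∀ n : ℕ, n • x ≤ y) → x ≤ 0

/-- A lattice bimorphism: a bilinear map `Φ : E × F → G` such that `Φ (x, ·)` and `Φ (·, y)` are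
lattice homomorphisms for all `x ≥ 0` and `y ≥ 0` (a linear map that preserves binary suprema
preserves binary infima as well). -/
structure IsLatticeBimorphism {E F G : Type*}
    [AddCommGroup E] [Lattice E] [Module ℝ E] [AddCommGroup F] [Lattice F] [Module ℝ F]
    [AddCommGroup G] [Lattice G] [Module ℝ G] (Φ : E →ₗ[ℝ] F →ₗ[ℝ] G) : Prop where
  map_sup_right : ∀ x : E, 0 ≤ x → ∀ y y' : F, Φ x (y ⊔ y') = Φ x y ⊔ Φ x y'
  map_sup_left : ∀ y : F, 0 ≤ y → ∀ x x' : E, Φ (x ⊔ x') y = Φ x y ⊔ Φ x' y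

/-- A lattice bimorphism of `E × F` into some Archimedean vector lattice `G`. -/
structure ArchBimorphism (E : Type u) (F : Type v)
    [AddCommGroup E] [Lattice E] [Module ℝ E] [AddCommGroup F] [Lattice F] [Module ℝ F] :
    Type (max u v + 1) where
  G : Type (max u v)
  [addCommGroup : AddCommGroup G]
  [lattice : Lattice G]
  [isOrderedAddMonoid : IsOrderedAddMonoid G]
  [module : Module ℝ G]
  [isOrderedModule : IsOrderedModule ℝ G]
  archimedean : IsArchimedeanLattice G
  Φ : E →ₗ[ℝ] F →ₗ[ℝ] G
  isLatticeBimorphism : IsLatticeBimorphism Φ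

attribute [instance] ArchBimorphism.addCommGroup ArchBimorphism.lattice
  ArchBimorphism.isOrderedAddMonoid ArchBimorphism.module ArchBimorphism.isOrderedModule

/-! ### The Fremlin tensor product

It is built as the Archimedean vector lattice generated by the symbols `x ⊗ y`, subject to the
relations that hold under every lattice bimorphism of `E × F` into an Archimedean vector lattice.
(A vector lattice generated by the image of a bimorphism of `E × F` is a quotient of
`FremlinTerm E F`, so it is enough to let the targets range over one universe.) -/

/-- Formal vector lattice expressions in the symbols `x ⊗ y`. -/
inductive FremlinTerm (E : Type u) (F : Type v) : Type (max u v)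
  | tmul (x : E) (y : F) : FremlinTerm E F
  | zero : FremlinTerm E F
  | add (s t : FremlinTerm E F) : FremlinTerm E F
  | smul (c : ℝ) (t : FremlinTerm E F) : FremlinTerm E F
  | sup (s t : FremlinTerm E F) : FremlinTerm E F

section Fremlin

variable {E : Type u} {F : Type v}
  [AddCommGroup E] [Lattice E] [Module ℝ E] [AddCommGroup F] [Lattice F] [Module ℝ F]

/-- The value of a formal expression under a lattice bimorphism. -/
def FremlinTerm.eval (B : ArchBimorphism E F) : FremlinTerm E F → B.G
  | .tmul x y => B.Φ x y
  | .zero => 0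
  | .add s t => s.eval B + t.eval B
  | .smul c t => c • t.eval B
  | .sup s t => s.eval B ⊔ t.eval B

variable (E F) in
/-- Two formal expressions are identified if they have the same value under every lattice
bimorphism into an Archimedean vector lattice. -/
def FremlinTerm.setoid : Setoid (FremlinTerm E F) where
  r s t := ∀ B : ArchBimorphism E F, s.eval B = t.eval B
  iseqv := ⟨fun _ _ => rfl, fun h B => (h B).symm, fun h h' B => (h B).trans (h' B)⟩

variable (E F) in
/-- The Fremlin tensor product of two vector lattices. -/
def FremlinTensor : Type (max u v) := Quotient (FremlinTerm.setoid E F)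

namespace FremlinTensor

/-- The map from the Fremlin tensor product to `G` induced by a lattice bimorphism into `G`. -/
def eval (B : ArchBimorphism E F) : FremlinTensor E F → B.G :=
  Quotient.lift (FremlinTerm.eval B) fun _ _ h => h B

theorem eval_injective {a b : FremlinTensor E F}
    (h : ∀ B : ArchBimorphism E F, eval B a = eval B b) : a = b := by
  induction a using Quotient.inductionOn
  induction b using Quotient.inductionOn
  exact Quotient.sound h

/-- The elementary tensor `x ⊗ y`. -/
def tmul (x : E) (y : F) : FremlinTensor E F := Quotient.mk _ (.tmul x y)

instance : Zero (FremlinTensor E F) := ⟨Quotient.mk _ .zero⟩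

instance : Add (FremlinTensor E F) :=
  ⟨Quotient.map₂ .add fun _ _ h _ _ h' B => congrArg₂ (· + ·) (h B) (h' B)⟩

instance : SMul ℝ (FremlinTensor E F) :=
  ⟨fun c => Quotient.map (.smul c) fun _ _ h B => congrArg (c • ·) (h B)⟩

instance : Neg (FremlinTensor E F) := ⟨fun a => (-1 : ℝ) • a⟩

variable (B : ArchBimorphism E F) (a b : FremlinTensor E F)

@[simp] theorem eval_tmul (x : E) (y : F) : eval B (tmul x y) = B.Φ x y := rfl

@[simp] theorem eval_zero : eval B 0 = 0 := rfl

@[simp] theorem eval_add : eval B (a + b) = eval B a + eval B b := by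
  induction a using Quotient.inductionOn
  induction b using Quotient.inductionOn
  rfl

@[simp] theorem eval_smul (c : ℝ) : eval B (c • a) = c • eval B a := by
  induction a using Quotient.inductionOn
  rfl

@[simp] theorem eval_neg : eval B (-a) = -eval B a :=
  (eval_smul B a (-1)).trans (neg_one_smul ℝ _)

instance : AddCommGroup (FremlinTensor E F) where
  add_assoc _ _ _ := eval_injective fun B => by simp [add_assoc]
  zero_add _ := eval_injective fun B => by simp
  add_zero _ := eval_injective fun B => by simp
  nsmul := nsmulRec
  zsmul := zsmulRec
  neg_add_cancel _ := eval_injective fun B => by simp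
  add_comm _ _ := eval_injective fun B => by simp [add_comm]

instance : Module ℝ (FremlinTensor E F) where
  one_smul _ := eval_injective fun B => by simp
  mul_smul _ _ _ := eval_injective fun B => by simp [mul_smul]
  smul_zero _ := eval_injective fun B => by simp
  smul_add _ _ _ := eval_injective fun B => by simp
  add_smul _ _ _ := eval_injective fun B => by simp [add_smul]
  zero_smul _ := eval_injective fun B => by simp

/-- The supremum of two elements of the Fremlin tensor product. -/
def sup : FremlinTensor E F → FremlinTensor E F → FremlinTensor E F :=
  Quotient.map₂ .sup fun _ _ h _ _ h' B => congrArg₂ (· ⊔ ·) (h B) (h' B)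

/-- The infimum of two elements of the Fremlin tensor product. -/
def inf (a b : FremlinTensor E F) : FremlinTensor E F := -sup (-a) (-b)

theorem eval_sup' : eval B (sup a b) = eval B a ⊔ eval B b := by
  induction a using Quotient.inductionOn
  induction b using Quotient.inductionOn
  rfl

theorem eval_inf' : eval B (inf a b) = eval B a ⊓ eval B b := by
  simp [inf, eval_sup', neg_sup]

/-- The vector lattice order: `a ≤ b` if this holds under every lattice bimorphism into an
Archimedean vector lattice. -/
instance : Lattice (FremlinTensor E F) where
  le a b := ∀ B : ArchBimorphism E F, eval B a ≤ eval B b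
  le_refl _ _ := le_rfl
  le_trans _ _ _ h h' B := (h B).trans (h' B)
  le_antisymm _ _ h h' := eval_injective fun B => le_antisymm (h B) (h' B)
  sup := sup
  inf := inf
  le_sup_left a b B := by rw [eval_sup']; exact le_sup_left
  le_sup_right a b B := by rw [eval_sup']; exact le_sup_right
  sup_le _ _ _ h h' B := by rw [eval_sup']; exact sup_le (h B) (h' B)
  inf_le_left _ _ B := by rw [eval_inf']; exact inf_le_left
  inf_le_right _ _ B := by rw [eval_inf']; exact inf_le_right
  le_inf _ _ _ h h' B := by rw [eval_inf']; exact le_inf (h B) (h' B)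

theorem le_iff {a b : FremlinTensor E F} :
    a ≤ b ↔ ∀ B : ArchBimorphism E F, eval B a ≤ eval B b := Iff.rfl

@[simp] theorem eval_sup : eval B (a ⊔ b) = eval B a ⊔ eval B b := eval_sup' B a b

@[simp] theorem eval_inf : eval B (a ⊓ b) = eval B a ⊓ eval B b := eval_inf' B a b

instance : IsOrderedAddMonoid (FremlinTensor E F) where
  add_le_add_left _ _ h c B := by simpa using h B

instance : IsOrderedModule ℝ (FremlinTensor E F) where
  smul_le_smul_of_nonneg_left c hc _ _ h B := by
    simpa using smul_le_smul_of_nonneg_left (h B) hc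
  smul_le_smul_of_nonneg_right a ha _ _ h B := by
    simpa using smul_le_smul_of_nonneg_right h (ha B)

variable (E F) in
theorem isArchimedeanLattice : IsArchimedeanLattice (FremlinTensor E F) := by
  intro x y h B
  refine B.archimedean (eval B x) (eval B y) fun n => ?_
  have := h n B
  rw [← Nat.cast_smul_eq_nsmul ℝ, eval_smul, Nat.cast_smul_eq_nsmul] at this
  exact this

/-- The canonical bilinear map `(x, y) ↦ x ⊗ y`. -/
def mk : E →ₗ[ℝ] F →ₗ[ℝ] FremlinTensor E F :=
  LinearMap.mk₂ ℝ tmul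
    (fun _ _ _ => eval_injective fun B => by simp) (fun _ _ _ => eval_injective fun B => by simp)
    (fun _ _ _ => eval_injective fun B => by simp) (fun _ _ _ => eval_injective fun B => by simp)

@[simp] theorem mk_apply (x : E) (y : F) : mk x y = tmul x y := rfl

theorem isLatticeBimorphism_mk : IsLatticeBimorphism (mk : E →ₗ[ℝ] F →ₗ[ℝ] FremlinTensor E F) where
  map_sup_right x hx y y' := eval_injective fun B => by
    exact (B.isLatticeBimorphism.map_sup_right x hx y y').trans
      (eval_sup B (tmul x y) (tmul x y')).symm
  map_sup_left y hy x x' := eval_injective fun B => by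
    exact (B.isLatticeBimorphism.map_sup_left y hy x x').trans
      (eval_sup B (tmul x y) (tmul x' y)).symm

/-- Every lattice bimorphism into an Archimedean vector lattice factors through a unique lattice
homomorphism of the Fremlin tensor product. -/
theorem existsUnique_lift (B : ArchBimorphism E F) :
    ∃! T : FremlinTensor E F →ₗ[ℝ] B.G,
      (∀ a b, T (a ⊔ b) = T a ⊔ T b) ∧ ∀ x y, T (tmul x y) = B.Φ x y := by
  refine ⟨⟨⟨eval B, eval_add B⟩, fun c a => eval_smul B a c⟩, ⟨eval_sup B, eval_tmul B⟩, ?_⟩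
  rintro T ⟨hs, ht⟩
  ext a
  induction a using Quotient.inductionOn with | _ t
  change T (Quotient.mk _ t) = t.eval B
  induction t with
  | tmul x y => exact ht x y
  | zero => exact T.map_zero
  | add s t h h' => exact (T.map_add _ _).trans (congrArg₂ _ h h')
  | smul c t h => exact (T.map_smul c _).trans (congrArg _ h)
  | sup s t h h' => exact (hs _ _).trans (congrArg₂ _ h h')

end FremlinTensor

end Fremlin

/-! ### Locally convex-solid vector lattices -/

open LatticeOrderedAddCommGroup (IsSolid solidClosure isSolid_solidClosure)

/-- Convex and solid neighbourhoods of zero. -/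
def IsConvexSolidNhd {E : Type*} [AddCommGroup E] [Lattice E] [Module ℝ E] [TopologicalSpace E]
    (U : Set E) : Prop :=
  U ∈ 𝓝 (0 : E) ∧ Convex ℝ U ∧ IsSolid U

/-- A locally convex-solid vector lattice: a vector lattice with a linear topology which has a base
at zero consisting of convex solid sets. -/
class LocallyConvexSolid (E : Type*) [AddCommGroup E] [Lattice E] [IsOrderedAddMonoid E]
    [Module ℝ E] [IsOrderedModule ℝ E] [TopologicalSpace E] : Prop
    extends IsTopologicalAddGroup E, ContinuousSMul ℝ E where
  hasBasis_zero : (𝓝 (0 : E)).HasBasis IsConvexSolidNhd id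

theorem abs_real_smul {G : Type*} [AddCommGroup G] [Lattice G] [IsOrderedAddMonoid G]
    [Module ℝ G] [IsOrderedModule ℝ G] (c : ℝ) (x : G) : |c • x| = |c| • |x| := by
  have pos : ∀ (c : ℝ) (x : G), 0 ≤ c → |c • x| ≤ c • |x| := fun c x hc =>
    abs_le'.2 ⟨smul_le_smul_of_nonneg_left (le_abs_self x) hc, by
      rw [← smul_neg]; exact smul_le_smul_of_nonneg_left (neg_le_abs x) hc⟩
  have le : ∀ (c : ℝ) (x : G), |c • x| ≤ |c| • |x| := by
    intro c x
    rcases le_total 0 c with hc | hc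
    · rw [abs_of_nonneg hc]
      exact pos c x hc
    · rw [abs_of_nonpos hc, ← abs_neg, ← neg_smul]
      exact pos (-c) x (neg_nonneg.2 hc)
  refine le_antisymm (le c x) ?_
  rcases eq_or_ne c 0 with rfl | hc
  · simp
  · have h := smul_le_smul_of_nonneg_left (le c⁻¹ (c • x)) (abs_nonneg c)
    rwa [smul_smul, smul_smul, inv_mul_cancel₀ hc, one_smul, ← abs_mul, mul_inv_cancel₀ hc,
      abs_one, one_smul] at h

section Topology

variable {E : Type u} {F : Type v}
  [AddCommGroup E] [Lattice E] [IsOrderedAddMonoid E] [Module ℝ E] [IsOrderedModule ℝ E]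
  [AddCommGroup F] [Lattice F] [IsOrderedAddMonoid F] [Module ℝ F] [IsOrderedModule ℝ F]

namespace FremlinTensor

/-- The set `Conv_b (Sol (U ⊗ V))`, where `U ⊗ V = {x ⊗ y | x ∈ U, y ∈ V}`, `Sol` is the solid
hull and `Conv_b` is the convex balanced hull. -/
def hull (U : Set E) (V : Set F) : Set (FremlinTensor E F) :=
  absConvexHull ℝ (solidClosure (Set.image2 tmul U V))

theorem hull_mono {U U' : Set E} {V V' : Set F} (hU : U ⊆ U') (hV : V ⊆ V') :
    hull U V ⊆ hull U' V' :=
  absConvexHull_mono fun _ ⟨a, ha, h⟩ => ⟨a, Set.image2_subset hU hV ha, h⟩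

theorem smul_mem_hull (c : ℝ) {U U' : Set E} {V : Set F} (h : ∀ x ∈ U', c • x ∈ U)
    {a : FremlinTensor E F} (ha : a ∈ hull U' V) : c • a ∈ hull U V := by
  have key : hull U' V ⊆ (fun a => c • a) ⁻¹' hull U V := by
    refine absConvexHull_min ?_ ⟨?_, ?_⟩
    · rintro a ⟨_, ⟨x, hx, y, hy, rfl⟩, hab⟩
      refine subset_absConvexHull ⟨tmul (c • x) y, ⟨_, h x hx, y, hy, rfl⟩, ?_⟩
      have e : tmul (c • x) y = c • tmul x y := eval_injective fun B => by simp
      change |c • a| ≤ _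
      rw [e, abs_real_smul, abs_real_smul]
      exact smul_le_smul_of_nonneg_left hab (abs_nonneg c)
    · refine balanced_iff_smul_mem.2 fun r hr a ha => ?_
      change c • r • a ∈ hull U V
      rw [smul_comm]
      exact balanced_absConvexHull.smul_mem hr ha
    · exact convex_absConvexHull.linear_preimage (LinearMap.lsmul ℝ (FremlinTensor E F) c)
  exact key ha

theorem abs_tmul_le (x : E) (y : F) : |tmul x y| ≤ tmul |x| |y| := by
  have pos : ∀ (x : E) (y : F), 0 ≤ x → 0 ≤ y → 0 ≤ mk x y := by
    intro x y hx hy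
    have h := isLatticeBimorphism_mk.map_sup_right x hx y 0
    rw [sup_eq_left.2 hy, map_zero] at h
    exact sup_eq_left.1 h.symm
  have h1 := pos _ _ (sub_nonneg.2 (le_abs_self x)) (neg_le_iff_add_nonneg'.1 (neg_le_abs y))
  have h2 := pos _ _ (neg_le_iff_add_nonneg'.1 (neg_le_abs x)) (sub_nonneg.2 (le_abs_self y))
  have h3 := pos _ _ (sub_nonneg.2 (le_abs_self x)) (sub_nonneg.2 (le_abs_self y))
  have h4 := pos _ _ (neg_le_iff_add_nonneg'.1 (neg_le_abs x)) (neg_le_iff_add_nonneg'.1 (neg_le_abs y))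
  change |mk x y| ≤ mk |x| |y|
  have half : ∀ z : FremlinTensor E F, 0 ≤ (2 : ℝ) • z → 0 ≤ z := fun z hz => by
    simpa using smul_nonneg (by norm_num : (0 : ℝ) ≤ 2⁻¹) hz
  refine abs_le'.2 ⟨sub_nonneg.1 (half _ ?_), sub_nonneg.1 (half _ ?_)⟩
  · refine (add_nonneg h1 h2).trans_eq ?_
    simp only [map_sub, map_add, LinearMap.sub_apply, LinearMap.add_apply]
    module
  · refine (add_nonneg h3 h4).trans_eq ?_
    simp only [map_sub, map_add, LinearMap.sub_apply, LinearMap.add_apply]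
    module

theorem exists_abs_le_tmul (a : FremlinTensor E F) :
    ∃ (x : E) (y : F), 0 ≤ x ∧ 0 ≤ y ∧ |a| ≤ tmul x y := by
  have mono : ∀ {x x' : E} {y y' : F}, 0 ≤ x → 0 ≤ x' → 0 ≤ y → 0 ≤ y' →
      tmul x y + tmul x' y' ≤ tmul (x + x') (y + y') := by
    intro x x' y y' hx hx' hy hy'
    have h1 := (abs_nonneg _).trans (abs_tmul_le x y')
    have h2 := (abs_nonneg _).trans (abs_tmul_le x' y)
    rw [abs_of_nonneg hx, abs_of_nonneg hy'] at h1
    rw [abs_of_nonneg hx', abs_of_nonneg hy] at h2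
    have e : tmul (x + x') (y + y') = tmul x y + tmul x' y' + (tmul x y' + tmul x' y) :=
      eval_injective fun B => by simp; abel
    rw [e]
    exact le_add_of_nonneg_right (add_nonneg h1 h2)
  induction a using Quotient.inductionOn with | _ t
  induction t with
  | tmul x y => exact ⟨|x|, |y|, abs_nonneg x, abs_nonneg y, abs_tmul_le x y⟩
  | zero =>
    refine ⟨0, 0, le_rfl, le_rfl, ?_⟩
    change |(0 : FremlinTensor E F)| ≤ _
    have e : tmul (0 : E) (0 : F) = 0 := eval_injective fun B => by simp
    rw [e, abs_zero]
  | add s t h h' =>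
    obtain ⟨x, y, hx, hy, h⟩ := h
    obtain ⟨x', y', hx', hy', h'⟩ := h'
    refine ⟨x + x', y + y', add_nonneg hx hx', add_nonneg hy hy', ?_⟩
    exact ((abs_add_le _ _).trans (add_le_add h h')).trans (mono hx hx' hy hy')
  | smul c t h =>
    obtain ⟨x, y, hx, hy, h⟩ := h
    refine ⟨|c| • x, y, smul_nonneg (abs_nonneg c) hx, hy, ?_⟩
    have e : tmul (|c| • x) y = |c| • tmul x y := eval_injective fun B => by simp
    rw [e]
    exact (abs_real_smul c _).trans_le (smul_le_smul_of_nonneg_left h (abs_nonneg c))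
  | sup s t h h' =>
    obtain ⟨x, y, hx, hy, h⟩ := h
    obtain ⟨x', y', hx', hy', h'⟩ := h'
    refine ⟨x + x', y + y', add_nonneg hx hx', add_nonneg hy hy', ?_⟩
    refine le_trans ?_ ((add_le_add h h').trans (mono hx hx' hy hy'))
    change |(Quotient.mk _ s ⊔ Quotient.mk _ t : FremlinTensor E F)| ≤ _
    refine abs_le'.2 ⟨sup_le ?_ ?_, (neg_sup _ _).trans_le (inf_le_left.trans ?_)⟩
    · exact (le_abs_self _).trans (le_add_of_nonneg_right (abs_nonneg _))
    · exact (le_abs_self _).trans (le_add_of_nonneg_left (abs_nonneg _))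
    · exact (neg_le_abs _).trans (le_add_of_nonneg_right (abs_nonneg _))

variable [TopologicalSpace E] [LocallyConvexSolid E] [TopologicalSpace F] [LocallyConvexSolid F]

theorem exists_convexSolidNhd_smul (c : ℝ) {U : Set E} (hU : IsConvexSolidNhd U) :
    ∃ U' : Set E, IsConvexSolidNhd U' ∧ ∀ x ∈ U', c • x ∈ U := by
  have h : (fun x : E => c • x) ⁻¹' U ∈ 𝓝 (0 : E) :=
    (continuous_const_smul c).continuousAt.preimage_mem_nhds (by simpa using hU.1)
  obtain ⟨U', hU', h'⟩ := LocallyConvexSolid.hasBasis_zero.mem_iff.1 h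
  exact ⟨U', hU', h'⟩

variable (E F) in
/-- The sets `Conv_b (Sol (U ⊗ V))`, for convex solid neighbourhoods of zero `U ⊆ E` and `V ⊆ F`,
form a base at zero for a linear topology on the Fremlin tensor product. -/
def moduleFilterBasis : ModuleFilterBasis ℝ (FremlinTensor E F) where
  sets := {W | ∃ (U : Set E) (V : Set F), IsConvexSolidNhd U ∧ IsConvexSolidNhd V ∧ W = hull U V}
  nonempty := by
    obtain ⟨U, hU, -⟩ := (LocallyConvexSolid.hasBasis_zero (E := E)).mem_iff.1 Filter.univ_mem
    obtain ⟨V, hV, -⟩ := (LocallyConvexSolid.hasBasis_zero (E := F)).mem_iff.1 Filter.univ_mem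
    exact ⟨_, U, V, hU, hV, rfl⟩
  inter_sets := by
    rintro _ _ ⟨U, V, hU, hV, rfl⟩ ⟨U', V', hU', hV', rfl⟩
    refine ⟨_, ⟨U ∩ U', V ∩ V',
      ⟨Filter.inter_mem hU.1 hU'.1, hU.2.1.inter hU'.2.1, ?_⟩,
      ⟨Filter.inter_mem hV.1 hV'.1, hV.2.1.inter hV'.2.1, ?_⟩, rfl⟩,
      Set.subset_inter (hull_mono Set.inter_subset_left Set.inter_subset_left)
        (hull_mono Set.inter_subset_right Set.inter_subset_right)⟩
    · exact fun x hx y h => ⟨hU.2.2 hx.1 h, hU'.2.2 hx.2 h⟩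
    · exact fun x hx y h => ⟨hV.2.2 hx.1 h, hV'.2.2 hx.2 h⟩
  zero' := by
    rintro _ ⟨U, V, hU, hV, rfl⟩
    refine subset_absConvexHull ⟨_, ⟨0, mem_of_mem_nhds hU.1, 0, mem_of_mem_nhds hV.1, rfl⟩, ?_⟩
    simp
  add' := by
    rintro _ ⟨U, V, hU, hV, rfl⟩
    obtain ⟨U', hU', h⟩ := exists_convexSolidNhd_smul 2 hU
    refine ⟨_, ⟨U', V, hU', hV, rfl⟩, ?_⟩
    rintro _ ⟨a, ha, b, hb, rfl⟩
    have := convex_absConvexHull (smul_mem_hull 2 h ha) (smul_mem_hull 2 h hb)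
      (by norm_num : (0 : ℝ) ≤ 2⁻¹) (by norm_num : (0 : ℝ) ≤ 2⁻¹) (by norm_num)
    simpa [hull] using this
  neg' := by
    rintro _ ⟨U, V, hU, hV, rfl⟩
    exact ⟨_, ⟨U, V, hU, hV, rfl⟩, fun a ha => balanced_absConvexHull.neg_mem_iff.2 ha⟩
  conj' := by
    rintro a _ ⟨U, V, hU, hV, rfl⟩
    refine ⟨_, ⟨U, V, hU, hV, rfl⟩, fun b hb => ?_⟩
    simpa [add_comm a b] using hb
  smul' := by
    rintro _ ⟨U, V, hU, hV, rfl⟩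
    refine ⟨Metric.closedBall 0 1, Metric.closedBall_mem_nhds _ one_pos,
      _, ⟨U, V, hU, hV, rfl⟩, ?_⟩
    rintro _ ⟨r, hr, a, ha, rfl⟩
    exact balanced_absConvexHull.smul_mem (by simpa using hr) ha
  smul_left' := by
    rintro c _ ⟨U, V, hU, hV, rfl⟩
    obtain ⟨U', hU', h⟩ := exists_convexSolidNhd_smul c hU
    exact ⟨_, ⟨U', V, hU', hV, rfl⟩, fun a ha => smul_mem_hull c h ha⟩
  smul_right' := by
    rintro a _ ⟨U, V, hU, hV, rfl⟩
    obtain ⟨x, y, hx, hy, h⟩ := exists_abs_le_tmul a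
    have hy' : ∀ᶠ r : ℝ in 𝓝 0, r • y ∈ V :=
      (continuous_id.smul continuous_const).continuousAt.eventually_mem (by simpa using hV.1)
    obtain ⟨ε, hε, hy'⟩ := Metric.eventually_nhds_iff.1 hy'
    have hd : (0 : ℝ) < ε / 2 := by positivity
    have hyV : (ε / 2) • y ∈ V := hy' (by simp [abs_of_pos hε, hε])
    have hx' : ∀ᶠ r : ℝ in 𝓝 0, (r * (ε / 2)⁻¹) • x ∈ U :=
      ((continuous_id.mul continuous_const).smul continuous_const).continuousAt.eventually_mem
        (by simpa using hU.1)
    filter_upwards [hx'] with r hr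
    refine subset_absConvexHull ⟨_, ⟨_, hU.2.2 hr (y := (|r| * (ε / 2)⁻¹) • x) ?_, _, hyV, rfl⟩, ?_⟩
    · rw [abs_real_smul, abs_real_smul, abs_mul, abs_mul, abs_abs]
    · have e : tmul ((|r| * (ε / 2)⁻¹) • x) ((ε / 2) • y) = |r| • tmul x y :=
        eval_injective fun B => by
          simp only [eval_tmul, eval_smul, map_smul, LinearMap.smul_apply, smul_smul]
          congr 1
          field_simp
      rw [e, abs_real_smul, abs_real_smul, abs_abs]
      exact smul_le_smul_of_nonneg_left (h.trans (le_abs_self _)) (abs_nonneg r)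

/-- The topology `τ_F` on the Fremlin tensor product. -/
instance : TopologicalSpace (FremlinTensor E F) := (moduleFilterBasis E F).topology

end FremlinTensor

end Topology

/-! ### Lattice homomorphisms on principal ideals -/

section UnitHom

variable {G : Type*} [AddCommGroup G] [Lattice G] [IsOrderedAddMonoid G] [Module ℝ G]
  [IsOrderedModule ℝ G]

/-! Convexity and solidity are the easy half: the convex balanced hull of a solid set is solid by
Riesz decomposition, so the basic sets of the topology are themselves convex and solid. The content
is that the topology separates points.

The tool is a function representation. In an Archimedean vector lattice, the order on the principal
ideal of `e ≥ 0` is determined by its real lattice homomorphisms normalised at `e`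
(`IsArchimedeanLattice.le_of_forall_isUnitHom`). If `ω` is such a functional on the ideal of `Φ e
f`, then `ω (Φ x y) = φ x * ψ y` for normalised lattice homomorphisms `φ`, `ψ` of the ideals of `e`
and `f`. Hence an inequality between formal expressions holds in the tensor product as soon as it
holds for all pairs `(φ, ψ)` (`ofTerm_le_ofTerm`). The converse (`value_le_of_ofTerm_le`) needs one
concrete Archimedean bimorphism: `(x, y)` goes to the germ of `(φ, ψ) ↦ φ x * ψ y` along ever larger
units. Germs are needed because `E` and `F` may have no global unit and few global real lattice
homomorphisms.

Two consequences give separation. First, every `z ≠ 0` has a multiple whose absolute value dominates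
some `a ⊗ b` with `a, b ≥ 0` nonzero: bound `|z|` below on a product of bump neighbourhoods. Second,
if `a, b ≥ 0` and `a ⊗ b` lies in the hull of `U ⊗ V`, then `a ∈ U` or `b ∈ V`. Choosing `U` without
`a` and `V` without `b` keeps that multiple of `z` out of the hull. -/

/-- The elements whose absolute value is dominated by a multiple of `e`. -/
def dominated (e : G) : Submodule ℝ G where
  carrier := {x | ∃ r : ℝ, 0 ≤ r ∧ |x| ≤ r • e}
  zero_mem' := ⟨0, le_rfl, by simp⟩
  add_mem' := by
    rintro x y ⟨r, hr, hx⟩ ⟨s, hs, hy⟩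
    exact ⟨r + s, add_nonneg hr hs, (abs_add_le x y).trans (by rw [add_smul]; exact add_le_add hx hy)⟩
  smul_mem' := by
    rintro c x ⟨r, hr, hx⟩
    refine ⟨|c| * r, mul_nonneg (abs_nonneg c) hr, ?_⟩
    rw [abs_real_smul, mul_smul]
    exact smul_le_smul_of_nonneg_left hx (abs_nonneg c)

theorem mem_dominated_of_abs_le {e x : G} (h : |x| ≤ e) : x ∈ dominated e :=
  ⟨1, zero_le_one, by rwa [one_smul]⟩

theorem mem_dominated_self {e : G} (he : 0 ≤ e) : e ∈ dominated e :=
  mem_dominated_of_abs_le (abs_of_nonneg he).le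

theorem dominated_solid {e x y : G} (h : |y| ≤ |x|) (hx : x ∈ dominated e) : y ∈ dominated e := by
  obtain ⟨r, hr, hx⟩ := hx
  exact ⟨r, hr, h.trans hx⟩

theorem abs_mem_dominated {e x : G} (hx : x ∈ dominated e) : |x| ∈ dominated e :=
  dominated_solid (abs_abs x).le hx

theorem dominated_mono {e e' : G} (h : e ≤ e') : dominated e ≤ dominated e' := by
  rintro x ⟨r, hr, hx⟩
  exact ⟨r, hr, hx.trans (smul_le_smul_of_nonneg_left h hr)⟩

/-- Reduces suprema to absolute values, so that a subspace or a linear functional only has to be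
checked against `|·|`. -/
theorem real_sup_eq (x y : G) : x ⊔ y = (2⁻¹ : ℝ) • (x + y + |y - x|) :=
  sup_eq_half_smul_add_add_abs_sub' ℝ x y

theorem sup_mem_dominated {e x y : G} (hx : x ∈ dominated e) (hy : y ∈ dominated e) :
    x ⊔ y ∈ dominated e := by
  rw [real_sup_eq]
  exact Submodule.smul_mem _ _ (add_mem (add_mem hx hy) (abs_mem_dominated (sub_mem hy hx)))

theorem posPart_mem_dominated {e x : G} (hx : x ∈ dominated e) : x⁺ ∈ dominated e :=
  sup_mem_dominated hx (zero_mem _)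

/-- A linear functional which restricts to a lattice homomorphism on the ideal generated by `e` and
takes the value `1` at `e`. -/
structure IsUnitHom (e : G) (φ : G →ₗ[ℝ] ℝ) : Prop where
  map_unit : φ e = 1
  map_abs : ∀ x ∈ dominated e, φ |x| = |φ x|

namespace IsUnitHom

variable {e : G} {φ : G →ₗ[ℝ] ℝ} (hφ : IsUnitHom e φ)
include hφ

theorem nonneg {x : G} (hx : x ∈ dominated e) (h : 0 ≤ x) : 0 ≤ φ x := by
  rw [← abs_of_nonneg h, hφ.map_abs x hx]
  exact abs_nonneg _

theorem mono {x y : G} (hx : x ∈ dominated e) (hy : y ∈ dominated e) (h : x ≤ y) : φ x ≤ φ y := by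
  have := hφ.nonneg (sub_mem hy hx) (sub_nonneg.2 h)
  rwa [map_sub, sub_nonneg] at this

theorem map_sup {x y : G} (hx : x ∈ dominated e) (hy : y ∈ dominated e) :
    φ (x ⊔ y) = φ x ⊔ φ y := by
  rw [real_sup_eq, real_sup_eq, map_smul, map_add, map_add, hφ.map_abs _ (sub_mem hy hx), map_sub]

theorem map_posPart {x : G} (hx : x ∈ dominated e) : φ x⁺ = φ x ⊔ 0 := by
  rw [posPart_def, hφ.map_sup hx (zero_mem _), map_zero]

theorem abs_le_of_abs_le {x : G} {r : ℝ} (he : 0 ≤ e) (hr : 0 ≤ r) (h : |x| ≤ r • e) :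
    |φ x| ≤ r := by
  have hx : x ∈ dominated e := ⟨r, hr, h⟩
  have := hφ.mono (abs_mem_dominated hx)
    (Submodule.smul_mem _ _ (mem_dominated_self he)) h
  rwa [hφ.map_abs x hx, map_smul, hφ.map_unit, smul_eq_mul, mul_one] at this

end IsUnitHom

/-! ### Prime ideals and the functionals they induce -/

/-- A convex set of positive elements, closed under addition. -/
structure IsPositiveIdeal (M : Set G) : Prop where
  nonneg : ∀ x ∈ M, 0 ≤ x
  zero_mem : 0 ∈ M
  add_mem : ∀ x ∈ M, ∀ y ∈ M, x + y ∈ M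
  mem_of_le : ∀ x ∈ M, ∀ y, 0 ≤ y → y ≤ x → y ∈ M

/-- The positive ideal generated by a positive ideal and an element. -/
theorem IsPositiveIdeal.extend {M : Set G} (hM : IsPositiveIdeal M) (u : G) :
    IsPositiveIdeal {z : G | 0 ≤ z ∧ ∃ m ∈ M, ∃ c : ℝ, 0 ≤ c ∧ z ≤ m + c • u} where
  nonneg _ h := h.1
  zero_mem := ⟨le_rfl, 0, hM.zero_mem, 0, le_rfl, by simp⟩
  add_mem := by
    rintro x ⟨hx, m, hm, c, hc, h⟩ y ⟨hy, m', hm', c', hc', h'⟩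
    refine ⟨add_nonneg hx hy, m + m', hM.add_mem _ hm _ hm', c + c', add_nonneg hc hc', ?_⟩
    refine (add_le_add h h').trans_eq ?_
    module
  mem_of_le := by
    rintro x ⟨hx, m, hm, c, hc, h⟩ y hy hyx
    exact ⟨hy, m, hm, c, hc, hyx.trans h⟩

theorem le_zero_of_smul_le_zero {c : ℝ} (hc : 0 < c) {x : G} (h : c • x ≤ 0) : x ≤ 0 := by
  have := smul_le_smul_of_nonneg_left h (inv_nonneg.2 hc.le)
  rwa [smul_smul, inv_mul_cancel₀ hc.ne', one_smul, smul_zero] at this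

/-- Zorn's lemma gives a maximal positive ideal containing `w` and avoiding `e`. Were disjoint `u`
and `v` both outside it, each would help to dominate `e`, and disjointness would then put `e` itself
inside. -/
theorem exists_isPositiveIdeal_prime {e w : G} (he : 0 ≤ e) (hw : 0 ≤ w)
    (h : ∀ c : ℝ, 0 ≤ c → ¬ e ≤ c • w) :
    ∃ M : Set G, IsPositiveIdeal M ∧ w ∈ M ∧ e ∉ M ∧
      ∀ u v : G, 0 ≤ u → 0 ≤ v → u ⊓ v = 0 → u ∈ M ∨ v ∈ M := by
  let S : Set (Set G) := {M | IsPositiveIdeal M ∧ e ∉ M}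
  have h0 : IsPositiveIdeal ({0} : Set G) :=
    ⟨by simp, by simp, by simp, by
      rintro x rfl y hy hyx
      exact le_antisymm hyx hy⟩
  obtain ⟨M, hwM, ⟨hM, heM⟩, hmax⟩ := zorn_subset_nonempty S (by
    intro c hc hchain ⟨N, hN⟩
    refine ⟨⋃₀ c, ⟨⟨?_, ?_, ?_, ?_⟩, ?_⟩, fun s hs => Set.subset_sUnion_of_mem hs⟩
    · rintro x ⟨s, hs, hx⟩
      exact (hc hs).1.nonneg x hx
    · exact ⟨N, hN, (hc hN).1.zero_mem⟩
    · rintro x ⟨s, hs, hx⟩ y ⟨t, ht, hy⟩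
      rcases hchain.total hs ht with hst | hst
      · exact ⟨t, ht, (hc ht).1.add_mem _ (hst hx) _ hy⟩
      · exact ⟨s, hs, (hc hs).1.add_mem _ hx _ (hst hy)⟩
    · rintro x ⟨s, hs, hx⟩ y hy hyx
      exact ⟨s, hs, (hc hs).1.mem_of_le x hx y hy hyx⟩
    · rintro ⟨s, hs, hx⟩
      exact (hc hs).2 hx) _ ⟨h0.extend w, by
        rintro ⟨-, m, rfl, c, hc, hle⟩
        exact h c hc (by simpa using hle)⟩
  refine ⟨M, hM, hwM ⟨hw, 0, rfl, 1, zero_le_one, by simp⟩, heM, ?_⟩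
  have key : ∀ u : G, 0 ≤ u → u ∉ M → ∃ m ∈ M, ∃ c : ℝ, 0 ≤ c ∧ e ≤ m + c • u := by
    intro u hu huM
    by_contra hne
    refine huM (hmax (y := {z : G | 0 ≤ z ∧ ∃ m ∈ M, ∃ c : ℝ, 0 ≤ c ∧ z ≤ m + c • u})
      ⟨hM.extend u, fun hmem => hne hmem.2⟩ ?_ ⟨hu, 0, hM.zero_mem, 1, zero_le_one, by simp⟩)
    exact fun z hz => ⟨hM.nonneg z hz, z, hz, 0, le_rfl, by simp⟩
  intro u v hu hv huv
  by_contra! hne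
  obtain ⟨m, hm, c, hc, h1⟩ := key u hu hne.1
  obtain ⟨m', hm', c', hc', h2⟩ := key v hv hne.2
  -- Dividing `e - (m + m')` by this number puts it below both `u` and `v`, hence below `u ⊓ v = 0`.
  -- The summand `1` only keeps the divisor positive.
  have hd : 0 < c + c' + 1 := by positivity
  refine heM (hM.mem_of_le _ (hM.add_mem _ hm _ hm') e he (sub_nonpos.1 ?_))
  refine le_zero_of_smul_le_zero (inv_pos.2 hd) ((le_inf ?_ ?_).trans_eq huv)
  · rw [inv_smul_le_iff_of_pos hd, sub_le_iff_le_add']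
    refine h1.trans (add_le_add (le_add_of_nonneg_right (hM.nonneg _ hm')) ?_)
    exact smul_le_smul_of_nonneg_right (by linarith) hu
  · rw [inv_smul_le_iff_of_pos hd, sub_le_iff_le_add']
    refine h2.trans (add_le_add (le_add_of_nonneg_left (hM.nonneg _ hm)) ?_)
    exact smul_le_smul_of_nonneg_right (by linarith) hv

/-- A total preorder on a vector lattice whose positive cone is compatible with absolute values
induces a lattice homomorphism on the principal ideal of `e`, by Dedekind cuts. -/
theorem exists_isUnitHom_of_rel {e : G} (he₀ : 0 ≤ e) (R : G → G → Prop)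
    (of_le : ∀ x y, x ≤ y → R x y) (trans : ∀ x y z, R x y → R y z → R x z)
    (total : ∀ x y, R x y ∨ R y x) (add : ∀ x y x' y', R x y → R x' y' → R (x + x') (y + y'))
    (smul : ∀ (c : ℝ) x y, 0 < c → R x y → R (c • x) (c • y)) (not_unit : ¬ R e 0)
    (abs : ∀ x, R 0 x → R |x| x) :
    ∃ φ : G →ₗ[ℝ] ℝ, IsUnitHom e φ ∧
      ∀ x ∈ dominated e, ∀ r : ℝ, R (r • e) x → r ≤ φ x := by
  have neg : ∀ x y, R x y → R (-y) (-x) := fun x y h => by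
    have := add _ _ _ _ h (of_le (-x - y) (-x - y) le_rfl)
    rwa [show x + (-x - y) = -y by abel, show y + (-x - y) = -x by abel] at this
  have unit : ∀ r s : ℝ, R (r • e) (s • e) → r ≤ s := by
    intro r s h
    by_contra! hlt
    have h1 := add _ _ _ _ h (of_le (-(s • e)) (-(s • e)) le_rfl)
    have h2 := smul (r - s)⁻¹ _ _ (inv_pos.2 (sub_pos.2 hlt)) h1
    rw [add_neg_cancel, smul_zero, ← sub_eq_add_neg, ← sub_smul, smul_smul,
      inv_mul_cancel₀ (sub_pos.2 hlt).ne', one_smul] at h2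
    exact not_unit h2
  -- The value at `x` is the infimum of its upper cut against multiples of `e`; `uniq` below
  -- identifies it from strict comparisons alone.
  let f : G → ℝ := fun x => sInf {r : ℝ | R x (r • e)}
  have lower : ∀ x ∈ dominated e, ∃ s : ℝ, R (s • e) x := by
    rintro x ⟨r, hr, hx⟩
    exact ⟨-r, of_le _ _ (by rw [neg_smul]; exact neg_le.1 ((neg_le_abs x).trans hx))⟩
  have upper : ∀ x ∈ dominated e, ∃ s : ℝ, R x (s • e) := by
    rintro x ⟨r, hr, hx⟩
    exact ⟨r, of_le _ _ ((le_abs_self x).trans hx)⟩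
  have le_f : ∀ x ∈ dominated e, ∀ r : ℝ, R (r • e) x → r ≤ f x := fun x hx r h =>
    le_csInf (upper x hx) fun s hs => unit r s (trans _ _ _ h hs)
  have f_le : ∀ x ∈ dominated e, ∀ r : ℝ, R x (r • e) → f x ≤ r := fun x hx r h => by
    obtain ⟨s, hs⟩ := lower x hx
    exact csInf_le ⟨s, fun t ht => unit s t (trans _ _ _ hs ht)⟩ h
  have above : ∀ x ∈ dominated e, ∀ r : ℝ, f x < r → R x (r • e) := fun x hx r h =>
    (total x (r • e)).resolve_right fun h' => (le_f x hx r h').not_gt h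
  have below : ∀ x ∈ dominated e, ∀ r : ℝ, r < f x → R (r • e) x := fun x hx r h =>
    (total x (r • e)).resolve_left fun h' => (f_le x hx r h').not_gt h
  have uniq : ∀ x ∈ dominated e, ∀ t : ℝ, (∀ r, t < r → R x (r • e)) → (∀ r, r < t → R (r • e) x) →
      f x = t := fun x hx t h1 h2 =>
    le_antisymm (le_of_forall_gt_imp_ge_of_dense fun r hr => f_le x hx r (h1 r hr))
      (le_of_forall_lt_imp_le_of_dense fun r hr => le_f x hx r (h2 r hr))
  have fadd : ∀ x ∈ dominated e, ∀ y ∈ dominated e, f (x + y) = f x + f y := by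
    intro x hx y hy
    refine uniq _ (add_mem hx hy) _ (fun r hr => ?_) fun r hr => ?_
    · have h := add _ _ _ _ (above x hx (f x + (r - f x - f y) / 2) (by linarith))
        (above y hy (f y + (r - f x - f y) / 2) (by linarith))
      rwa [← add_smul, show f x + (r - f x - f y) / 2 + (f y + (r - f x - f y) / 2) = r by ring] at h
    · have h := add _ _ _ _ (below x hx (f x + (r - f x - f y) / 2) (by linarith))
        (below y hy (f y + (r - f x - f y) / 2) (by linarith))
      rwa [← add_smul, show f x + (r - f x - f y) / 2 + (f y + (r - f x - f y) / 2) = r by ring] at h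
  have fneg : ∀ x ∈ dominated e, f (-x) = -f x := by
    intro x hx
    refine uniq _ (neg_mem hx) _ (fun r hr => ?_) fun r hr => ?_
    · simpa using neg _ _ (below x hx (-r) (by linarith))
    · simpa using neg _ _ (above x hx (-r) (by linarith))
  have fsmul_pos : ∀ c : ℝ, 0 < c → ∀ x ∈ dominated e, f (c • x) = c * f x := by
    intro c hc x hx
    refine uniq _ (Submodule.smul_mem _ _ hx) _ (fun r hr => ?_) fun r hr => ?_
    · have h := smul c _ _ hc (above x hx (r / c) (by rwa [lt_div_iff₀' hc]))
      rwa [smul_smul, mul_div_cancel₀ _ hc.ne'] at h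
    · have h := smul c _ _ hc (below x hx (r / c) (by rwa [div_lt_iff₀' hc]))
      rwa [smul_smul, mul_div_cancel₀ _ hc.ne'] at h
  have f0 : f 0 = 0 := by simpa using fadd 0 (zero_mem _) 0 (zero_mem _)
  have fsmul : ∀ c : ℝ, ∀ x ∈ dominated e, f (c • x) = c * f x := by
    intro c x hx
    rcases lt_trichotomy c 0 with hc | rfl | hc
    · have := fsmul_pos (-c) (neg_pos.2 hc) x hx
      rw [neg_smul, fneg _ (Submodule.smul_mem _ _ hx)] at this
      linarith
    · simp [f0]
    · exact fsmul_pos c hc x hx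
  let ψ : dominated e →ₗ[ℝ] ℝ :=
    { toFun := fun x => f x
      map_add' := fun x y => fadd x x.2 y y.2
      map_smul' := fun c x => fsmul c x x.2 }
  obtain ⟨φ, hφ⟩ := LinearMap.exists_extend ψ
  have hval : ∀ x ∈ dominated e, φ x = f x := fun x hx => LinearMap.congr_fun hφ ⟨x, hx⟩
  have he : e ∈ dominated e := mem_dominated_self he₀
  have fabs_of : ∀ x ∈ dominated e, R 0 x → f |x| = |f x| := by
    intro x hx h
    rw [abs_of_nonneg (le_f x hx 0 (by simpa using h))]
    refine uniq _ (abs_mem_dominated hx) _ (fun r hr => trans _ _ _ (abs x h) (above x hx r hr))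
      fun r hr => trans _ _ _ (below x hx r hr) (of_le _ _ (le_abs_self x))
  refine ⟨φ, ⟨?_, ?_⟩, fun x hx r h => (le_f x hx r h).trans_eq (hval x hx).symm⟩
  · rw [hval e he]
    refine le_antisymm (f_le e he 1 (of_le _ _ (by simp))) (le_f e he 1 (of_le _ _ (by simp)))
  · intro x hx
    rw [hval x hx, hval _ (abs_mem_dominated hx)]
    rcases total 0 x with h | h
    · exact fabs_of x hx h
    · rw [← abs_neg x, fabs_of _ (neg_mem hx) (by simpa using neg _ _ h), fneg x hx, _root_.abs_neg]

/-- An Archimedean vector lattice is separated, on the ideal generated by a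
positive element, by its real lattice homomorphisms. -/
theorem IsArchimedeanLattice.exists_isUnitHom (hG : IsArchimedeanLattice G) {e w : G} (he : 0 ≤ e)
    (hw : w ∈ dominated e) (hw0 : ¬ w ≤ 0) : ∃ φ : G →ₗ[ℝ] ℝ, IsUnitHom e φ ∧ 0 < φ w := by
  obtain ⟨n, hn⟩ : ∃ n : ℕ, ¬ n • w ≤ e := by
    by_contra! h
    exact hw0 (hG w e h)
  have hn0 : (0 : ℝ) < n := by
    rcases Nat.eq_zero_or_pos n with rfl | h
    · exact absurd (by simpa using he) hn
    · exact_mod_cast h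
  -- Subtracting `δ • e` from `w` leaves an element that is still not `≤ 0`; this margin makes the
  -- final value at `w` at least `δ`, not merely nonnegative.
  set δ : ℝ := (n : ℝ)⁻¹ with hδ
  have hδ0 : 0 < δ := inv_pos.2 hn0
  set x := w - δ • e with hxdef
  have hx : ¬ x ≤ 0 := fun h => hn <| by
    have := smul_le_smul_of_nonneg_left (sub_nonpos.1 h) hn0.le
    rwa [smul_smul, hδ, mul_inv_cancel₀ hn0.ne', one_smul, Nat.cast_smul_eq_nsmul] at this
  have hxe : x ∈ dominated e := sub_mem hw (Submodule.smul_mem _ _ (mem_dominated_self he))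
  obtain ⟨s, hs, hxs⟩ := posPart_mem_dominated hxe
  rw [abs_of_nonneg (posPart_nonneg x)] at hxs
  -- If `e ≤ c • x⁻`, then `x⁺` is below a multiple of `x⁻`; being disjoint from it, `x⁺` would
  -- vanish.
  obtain ⟨M, hM, hxM, heM, hprime⟩ := exists_isPositiveIdeal_prime he (negPart_nonneg x) (by
    intro c hc hle
    have hd : 0 < s * c + 1 := by positivity
    have h1 : (s * c + 1)⁻¹ • x⁺ ≤ x⁻ := by
      rw [inv_smul_le_iff_of_pos hd]
      refine hxs.trans ((smul_le_smul_of_nonneg_left hle hs).trans ?_)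
      rw [smul_smul]
      exact smul_le_smul_of_nonneg_right (by linarith) (negPart_nonneg x)
    have h2 : (s * c + 1)⁻¹ • x⁺ ≤ x⁺ := by
      have := smul_le_smul_of_nonneg_right (inv_le_one_of_one_le₀
        (by nlinarith [mul_nonneg hs hc] : 1 ≤ s * c + 1)) (posPart_nonneg x)
      rwa [one_smul] at this
    refine hx ((le_posPart x).trans (le_zero_of_smul_le_zero (inv_pos.2 hd) ?_))
    exact (le_inf h2 h1).trans_eq (posPart_inf_negPart_eq_zero x))
  -- Compare elements modulo `M`. Primeness applied to the positive and negative parts of `x - y`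
  -- makes the comparison total.
  obtain ⟨φ, hφ, hle⟩ := exists_isUnitHom_of_rel he (fun x y => (x - y)⁺ ∈ M)
    (fun x y h => by
      rw [posPart_eq_zero.2 (sub_nonpos.2 h)]; exact hM.zero_mem)
    (fun x y z h h' => hM.mem_of_le _ (hM.add_mem _ h _ h') _ (posPart_nonneg _) (by
      refine sup_le ?_ (add_nonneg (posPart_nonneg _) (posPart_nonneg _))
      rw [← sub_add_sub_cancel x y z]
      exact add_le_add (le_posPart _) (le_posPart _)))
    (fun x y => by
      have := hprime _ _ (posPart_nonneg (x - y)) (negPart_nonneg (x - y))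
        (posPart_inf_negPart_eq_zero _)
      rwa [← posPart_neg, neg_sub] at this)
    (fun x y x' y' h h' => hM.mem_of_le _ (hM.add_mem _ h _ h') _ (posPart_nonneg _) (by
      refine sup_le ?_ (add_nonneg (posPart_nonneg _) (posPart_nonneg _))
      rw [add_sub_add_comm]
      exact add_le_add (le_posPart _) (le_posPart _)))
    (fun c x y hc h => by
      -- `M` is only assumed closed under addition, so real multiples are reached through natural
      -- ones and downward closure.
      have hnat : ∀ n : ℕ, n • (x - y)⁺ ∈ M := by
        intro n
        induction n with
        | zero => simpa using hM.zero_mem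
        | succ n ih => rw [succ_nsmul]; exact hM.add_mem _ ih _ h
      obtain ⟨n, hn⟩ := exists_nat_ge c
      refine hM.mem_of_le _ (hnat n) _ (posPart_nonneg _) ?_
      rw [← Nat.cast_smul_eq_nsmul ℝ]
      refine le_trans (sup_le ?_ (smul_nonneg hc.le (posPart_nonneg (x - y))))
        (smul_le_smul_of_nonneg_right hn (posPart_nonneg (x - y)))
      rw [← smul_sub]
      exact smul_le_smul_of_nonneg_left (le_posPart _) hc.le)
    (by rwa [sub_zero, posPart_of_nonneg he])
    (fun x h => by
      rw [zero_sub, posPart_neg] at h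
      rw [abs_sub_eq_two_nsmul_negPart, posPart_of_nonneg (nsmul_nonneg (negPart_nonneg x) 2),
        two_nsmul]
      exact hM.add_mem _ h _ h)
  refine ⟨φ, hφ, hδ0.trans_le (hle w hw δ ?_)⟩
  rwa [← neg_sub, posPart_neg]

/-- On the ideal generated by a positive element, the order of an Archimedean vector lattice is
determined by its real lattice homomorphisms. -/
theorem IsArchimedeanLattice.le_of_forall_isUnitHom (hG : IsArchimedeanLattice G) {e x y : G}
    (he : 0 ≤ e) (hx : x ∈ dominated e) (hy : y ∈ dominated e)
    (h : ∀ φ : G →ₗ[ℝ] ℝ, IsUnitHom e φ → φ x ≤ φ y) : x ≤ y := by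
  by_contra hxy
  obtain ⟨φ, hφ, hpos⟩ := hG.exists_isUnitHom he (sub_mem hx hy) fun h => hxy (sub_nonpos.1 h)
  rw [map_sub, sub_pos] at hpos
  exact hpos.not_ge (h φ hφ)

end UnitHom

/-! ### Values of formal expressions under pairs of functionals -/

section TermValue

variable {E : Type u} {F : Type v}
  [AddCommGroup E] [Lattice E] [IsOrderedAddMonoid E] [Module ℝ E] [IsOrderedModule ℝ E]
  [AddCommGroup F] [Lattice F] [IsOrderedAddMonoid F] [Module ℝ F] [IsOrderedModule ℝ F]

namespace FremlinTerm

/-- The value of a formal expression when `x ⊗ y` is interpreted as `φ x * ψ y`. -/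
def value (φ : E →ₗ[ℝ] ℝ) (ψ : F →ₗ[ℝ] ℝ) : FremlinTerm E F → ℝ
  | .tmul x y => φ x * ψ y
  | .zero => 0
  | .add s t => s.value φ ψ + t.value φ ψ
  | .smul c t => c * t.value φ ψ
  | .sup s t => s.value φ ψ ⊔ t.value φ ψ

/-- All symbols `x ⊗ y` of the expression satisfy `x ∈ dominated e` and `y ∈ dominated f`. -/
def Dominated (e : E) (f : F) : FremlinTerm E F → Prop
  | .tmul x y => x ∈ dominated e ∧ y ∈ dominated f
  | .zero => True
  | .add s t => s.Dominated e f ∧ t.Dominated e f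
  | .smul _ t => t.Dominated e f
  | .sup s t => s.Dominated e f ∧ t.Dominated e f

theorem Dominated.mono {e e' : E} {f f' : F} (he : e ≤ e') (hf : f ≤ f') {t : FremlinTerm E F}
    (ht : t.Dominated e f) : t.Dominated e' f' := by
  induction t with
  | tmul x y => exact ⟨dominated_mono he ht.1, dominated_mono hf ht.2⟩
  | zero => trivial
  | add s t h h' => exact ⟨h ht.1, h' ht.2⟩
  | smul c t h => exact h ht
  | sup s t h h' => exact ⟨h ht.1, h' ht.2⟩

theorem exists_dominated (t : FremlinTerm E F) :
    ∃ (e : E) (f : F), 0 ≤ e ∧ 0 ≤ f ∧ t.Dominated e f := by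
  have binary : ∀ s t : FremlinTerm E F, (∃ (e : E) (f : F), 0 ≤ e ∧ 0 ≤ f ∧ s.Dominated e f) →
      (∃ (e : E) (f : F), 0 ≤ e ∧ 0 ≤ f ∧ t.Dominated e f) →
      ∃ (e : E) (f : F), 0 ≤ e ∧ 0 ≤ f ∧ s.Dominated e f ∧ t.Dominated e f := by
    rintro s t ⟨e, f, he, hf, hs⟩ ⟨e', f', he', hf', ht⟩
    exact ⟨e ⊔ e', f ⊔ f', le_sup_of_le_left he, le_sup_of_le_left hf,
      hs.mono le_sup_left le_sup_left, ht.mono le_sup_right le_sup_right⟩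
  induction t with
  | tmul x y =>
    exact ⟨|x|, |y|, abs_nonneg x, abs_nonneg y, mem_dominated_of_abs_le le_rfl,
      mem_dominated_of_abs_le le_rfl⟩
  | zero => exact ⟨0, 0, le_rfl, le_rfl, trivial⟩
  | add s t h h' => exact binary s t h h'
  | smul c t h => exact h
  | sup s t h h' => exact binary s t h h'

/-- Values are positively homogeneous in each functional, so an inequality between two of them
survives renormalising the functionals at other units. -/
theorem value_smul_smul {c d : ℝ} (hc : 0 ≤ c) (hd : 0 ≤ d) (φ : E →ₗ[ℝ] ℝ) (ψ : F →ₗ[ℝ] ℝ)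
    (t : FremlinTerm E F) : t.value (c • φ) (d • ψ) = c * d * t.value φ ψ := by
  induction t with
  | tmul x y => simp only [value, LinearMap.smul_apply, smul_eq_mul]; ring
  | zero => simp [value]
  | add s t h h' => simp only [value, h, h']; ring
  | smul c t h => simp only [value, h]; ring
  | sup s t h h' => simp only [value, h, h', mul_max_of_nonneg _ _ (mul_nonneg hc hd)]

end FremlinTerm

/-! ### Splitting a functional of a bimorphism into a product -/

namespace ArchBimorphism

variable (B : ArchBimorphism E F)

theorem apply_nonneg {x : E} {y : F} (hx : 0 ≤ x) (hy : 0 ≤ y) : 0 ≤ B.Φ x y := by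
  have h := B.isLatticeBimorphism.map_sup_right x hx y 0
  rw [sup_eq_left.2 hy, map_zero] at h
  exact sup_eq_left.1 h.symm

theorem abs_apply_le_smul {x : E} {y f : F} {s : ℝ} (h : |y| ≤ s • f) :
    |B.Φ x y| ≤ s • B.Φ |x| f := by
  have h1 := FremlinTensor.abs_tmul_le x y B
  rw [abs, FremlinTensor.eval_sup, FremlinTensor.eval_neg, FremlinTensor.eval_tmul,
    FremlinTensor.eval_tmul] at h1
  have h2 := B.apply_nonneg (abs_nonneg x) (sub_nonneg.2 h)
  rw [map_sub, map_smul, sub_nonneg] at h2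
  exact h1.trans h2

theorem apply_abs_left (x : E) {y : F} (hy : 0 ≤ y) : B.Φ |x| y = |B.Φ x y| := by
  rw [abs, B.isLatticeBimorphism.map_sup_left y hy, abs, map_neg, LinearMap.neg_apply]

theorem apply_abs_right {x : E} (y : F) (hx : 0 ≤ x) : B.Φ x |y| = |B.Φ x y| := by
  rw [abs, B.isLatticeBimorphism.map_sup_right x hx, abs, map_neg]

theorem apply_mem_dominated {e x : E} {f y : F} (hf : 0 ≤ f) (hx : x ∈ dominated e)
    (hy : y ∈ dominated f) : B.Φ x y ∈ dominated (B.Φ e f) := by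
  obtain ⟨r, hr, hx⟩ := hx
  obtain ⟨s, hs, hy⟩ := hy
  refine ⟨s * r, mul_nonneg hs hr, (B.abs_apply_le_smul hy).trans ?_⟩
  rw [mul_smul]
  refine smul_le_smul_of_nonneg_left ?_ hs
  simpa using B.apply_nonneg (sub_nonneg.2 hx) hf

theorem eval_mem_dominated {e : E} {f : F} (hf : 0 ≤ f) {t : FremlinTerm E F}
    (ht : t.Dominated e f) : t.eval B ∈ dominated (B.Φ e f) := by
  induction t with
  | tmul x y => exact B.apply_mem_dominated hf ht.1 ht.2
  | zero => exact zero_mem _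
  | add s t h h' => exact add_mem (h ht.1) (h' ht.2)
  | smul c t h => exact Submodule.smul_mem _ c (h ht)
  | sup s t h h' => exact sup_mem_dominated (h ht.1) (h' ht.2)

/-- A lattice bimorphism into an Archimedean vector lattice, followed by a real lattice
homomorphism, is a product of real lattice homomorphisms. -/
theorem exists_value_eq {e : E} {f : F} (he : 0 ≤ e) (hf : 0 ≤ f) {ω : B.G →ₗ[ℝ] ℝ}
    (hω : IsUnitHom (B.Φ e f) ω) :
    ∃ (φ : E →ₗ[ℝ] ℝ) (ψ : F →ₗ[ℝ] ℝ), IsUnitHom e φ ∧ IsUnitHom f ψ ∧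
      ∀ t : FremlinTerm E F, t.Dominated e f → ω (t.eval B) = t.value φ ψ := by
  have hee := mem_dominated_self he
  have hff := mem_dominated_self hf
  have hφ : IsUnitHom e (ω ∘ₗ B.Φ.flip f) := ⟨hω.map_unit, fun x hx => by
    change ω (B.Φ |x| f) = |ω (B.Φ x f)|
    rw [B.apply_abs_left x hf, hω.map_abs _ (B.apply_mem_dominated hf hx hff)]⟩
  have hψ : IsUnitHom f (ω ∘ₗ B.Φ e) := ⟨hω.map_unit, fun y hy => by
    change ω (B.Φ e |y|) = |ω (B.Φ e y)|
    rw [B.apply_abs_right y he, hω.map_abs _ (B.apply_mem_dominated hf hee hy)]⟩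
  refine ⟨_, _, hφ, hψ, fun t ht => ?_⟩
  induction t with
  | tmul x y =>
    change ω (B.Φ x y) = ω (B.Φ x f) * ω (B.Φ e y)
    set c := ω (B.Φ x f) with hc
    -- Subtracting `c • e` puts `x` in the kernel of `ω (Φ · f)`. Since `|Φ x' y| ≤ s • Φ |x'| f`,
    -- the element `x' = x - c • e` is then killed by `ω (Φ · y)` for every `y` in the ideal of `f`.
    have hx' : x - c • e ∈ dominated e := sub_mem ht.1 (Submodule.smul_mem _ _ hee)
    have h0 : ω (B.Φ |x - c • e| f) = 0 := by
      rw [B.apply_abs_left _ hf, hω.map_abs _ (B.apply_mem_dominated hf hx' hff)]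
      simp [hω.map_unit, ← hc]
    obtain ⟨s, hs, hy⟩ := id ht.2
    have h1 := hω.mono (abs_mem_dominated (B.apply_mem_dominated hf hx' ht.2))
      (Submodule.smul_mem _ s (B.apply_mem_dominated hf (abs_mem_dominated hx') hff))
      (B.abs_apply_le_smul hy)
    rw [hω.map_abs _ (B.apply_mem_dominated hf hx' ht.2), map_smul, h0, smul_zero] at h1
    have h2 := abs_nonpos_iff.1 h1
    rwa [map_sub, LinearMap.sub_apply, map_sub, map_smul, LinearMap.smul_apply, map_smul,
      sub_eq_zero] at h2
  | zero => exact map_zero ω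
  | add s t h h' => exact (map_add ω _ _).trans (congrArg₂ _ (h ht.1) (h' ht.2))
  | smul c t h => exact (map_smul ω c _).trans (congrArg _ (h ht))
  | sup s t h h' =>
    exact (hω.map_sup (B.eval_mem_dominated hf ht.1) (B.eval_mem_dominated hf ht.2)).trans
      (congrArg₂ _ (h ht.1) (h' ht.2))

end ArchBimorphism

namespace FremlinTensor

/-- The element of the Fremlin tensor product denoted by a formal expression. -/
def ofTerm (t : FremlinTerm E F) : FremlinTensor E F := Quotient.mk _ t

theorem exists_ofTerm (z : FremlinTensor E F) : ∃ t, ofTerm t = z := Quotient.exists_rep z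

@[simp] theorem eval_ofTerm (B : ArchBimorphism E F) (t : FremlinTerm E F) :
    eval B (ofTerm t) = t.eval B := rfl

/-- The order of the Fremlin tensor product can be tested on pairs of real lattice homomorphisms of
principal ideals. -/
theorem ofTerm_le_ofTerm {e : E} {f : F} (he : 0 ≤ e) (hf : 0 ≤ f) {s t : FremlinTerm E F}
    (hs : s.Dominated e f) (ht : t.Dominated e f)
    (h : ∀ φ ψ, IsUnitHom e φ → IsUnitHom f ψ → s.value φ ψ ≤ t.value φ ψ) :
    ofTerm s ≤ ofTerm t := by
  intro B
  refine B.archimedean.le_of_forall_isUnitHom (B.apply_nonneg he hf) (B.eval_mem_dominated hf hs)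
    (B.eval_mem_dominated hf ht) fun ω hω => ?_
  obtain ⟨φ, ψ, hφ, hψ, hval⟩ := B.exists_value_eq he hf hω
  exact ((hval s hs).trans_le (h φ ψ hφ hψ)).trans_eq (hval t ht).symm

end FremlinTensor

/-! ### Neighbourhoods of a real lattice homomorphism -/

/-- The filter of neighbourhoods of `φ₀` among the real lattice homomorphisms of the ideal generated
by `e`. -/
def bumpFilter (e : E) (φ₀ : E →ₗ[ℝ] ℝ) : Filter (E →ₗ[ℝ] ℝ) :=
  ⨅ a ∈ {a : E | 0 ≤ a ∧ a ∈ dominated e ∧ 0 < φ₀ a}, Filter.principal {φ | IsUnitHom e φ ∧ 0 < φ a}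

/-- The sets `{φ | 0 < φ a}` are directed because `φ (a ⊓ b) = φ a ⊓ φ b`, so a single bump `a`
describes a neighbourhood. -/
theorem mem_bumpFilter {e : E} (he : 0 ≤ e) {φ₀ : E →ₗ[ℝ] ℝ} (hφ₀ : IsUnitHom e φ₀)
    {s : Set (E →ₗ[ℝ] ℝ)} : s ∈ bumpFilter e φ₀ ↔
      ∃ a : E, 0 ≤ a ∧ a ∈ dominated e ∧ 0 < φ₀ a ∧ ∀ φ, IsUnitHom e φ → 0 < φ a → φ ∈ s := by
  have inf_eq : ∀ a b : E, a ⊓ b = -(-a ⊔ -b) := fun a b => by rw [neg_sup, neg_neg, neg_neg]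
  have inf_mem : ∀ a ∈ dominated e, ∀ b ∈ dominated e, a ⊓ b ∈ dominated e := fun a ha b hb => by
    rw [inf_eq]; exact neg_mem (sup_mem_dominated (neg_mem ha) (neg_mem hb))
  have inf_val : ∀ φ : E →ₗ[ℝ] ℝ, IsUnitHom e φ → ∀ a ∈ dominated e, ∀ b ∈ dominated e,
      φ (a ⊓ b) = φ a ⊓ φ b := fun φ hφ a ha b hb => by
    rw [inf_eq, map_neg, hφ.map_sup (neg_mem ha) (neg_mem hb), map_neg, map_neg, neg_sup, neg_neg,
      neg_neg]
  rw [bumpFilter, Filter.mem_biInf_of_directed]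
  · constructor
    · rintro ⟨a, ⟨h1, h2, h3⟩, h⟩
      exact ⟨a, h1, h2, h3, fun φ hφ ha => h ⟨hφ, ha⟩⟩
    · rintro ⟨a, h1, h2, h3, h⟩
      exact ⟨a, ⟨h1, h2, h3⟩, fun φ hφ => h φ hφ.1 hφ.2⟩
  · rintro a ⟨ha, hae, ha0⟩ b ⟨hb, hbe, hb0⟩
    refine ⟨a ⊓ b, ⟨le_inf ha hb, inf_mem a hae b hbe, ?_⟩, ?_, ?_⟩
    · rw [inf_val φ₀ hφ₀ a hae b hbe]; exact lt_inf_iff.2 ⟨ha0, hb0⟩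
    · refine Filter.principal_mono.2 fun φ hφ => ⟨hφ.1, ?_⟩
      have := hφ.2
      rw [inf_val φ hφ.1 a hae b hbe] at this
      exact (lt_inf_iff.1 this).1
    · refine Filter.principal_mono.2 fun φ hφ => ⟨hφ.1, ?_⟩
      have := hφ.2
      rw [inf_val φ hφ.1 a hae b hbe] at this
      exact (lt_inf_iff.1 this).2
  · exact ⟨e, he, mem_dominated_self he, by rw [hφ₀.map_unit]; exact one_pos⟩

/-- The condition `|φ x - φ₀ x| < ε` says exactly that `φ` is positive at the bump `(ε • e - |x - φ₀
x • e|)⁺`. -/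
theorem tendsto_apply_bumpFilter {e : E} (he : 0 ≤ e) {φ₀ : E →ₗ[ℝ] ℝ} (hφ₀ : IsUnitHom e φ₀)
    {x : E} (hx : x ∈ dominated e) :
    Filter.Tendsto (fun φ : E →ₗ[ℝ] ℝ => φ x) (bumpFilter e φ₀) (𝓝 (φ₀ x)) := by
  rw [Metric.tendsto_nhds]
  intro ε hε
  have hee := mem_dominated_self he
  have hy : x - φ₀ x • e ∈ dominated e := sub_mem hx (Submodule.smul_mem _ _ hee)
  have hz : ε • e - |x - φ₀ x • e| ∈ dominated e :=
    sub_mem (Submodule.smul_mem _ _ hee) (abs_mem_dominated hy)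
  have val : ∀ φ : E →ₗ[ℝ] ℝ, IsUnitHom e φ →
      φ (ε • e - |x - φ₀ x • e|)⁺ = (ε - |φ x - φ₀ x|) ⊔ 0 := fun φ hφ => by
    rw [hφ.map_posPart hz, map_sub, hφ.map_abs _ hy, map_sub, map_smul, map_smul, hφ.map_unit,
      smul_eq_mul, smul_eq_mul, mul_one, mul_one]
  refine (mem_bumpFilter he hφ₀).2 ⟨(ε • e - |x - φ₀ x • e|)⁺, posPart_nonneg _,
    posPart_mem_dominated hz, ?_, fun φ hφ h => ?_⟩
  · rw [val φ₀ hφ₀]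
    simpa using hε
  · rw [val φ hφ] at h
    have := (lt_max_iff.1 h).resolve_right (lt_irrefl _)
    exact sub_pos.1 this

theorem tendsto_value_bumpFilter {e : E} {f : F} (he : 0 ≤ e) (hf : 0 ≤ f) {φ₀ : E →ₗ[ℝ] ℝ}
    {ψ₀ : F →ₗ[ℝ] ℝ} (hφ₀ : IsUnitHom e φ₀) (hψ₀ : IsUnitHom f ψ₀) {t : FremlinTerm E F}
    (ht : t.Dominated e f) :
    Filter.Tendsto (fun p : (E →ₗ[ℝ] ℝ) × (F →ₗ[ℝ] ℝ) => t.value p.1 p.2)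
      (bumpFilter e φ₀ ×ˢ bumpFilter f ψ₀) (𝓝 (t.value φ₀ ψ₀)) := by
  induction t with
  | tmul x y =>
    exact ((tendsto_apply_bumpFilter he hφ₀ ht.1).comp Filter.tendsto_fst).mul
      ((tendsto_apply_bumpFilter hf hψ₀ ht.2).comp Filter.tendsto_snd)
  | zero => exact tendsto_const_nhds
  | add s t h h' => exact (h ht.1).add (h' ht.2)
  | smul c t h => exact (h ht).const_mul c
  | sup s t h h' => exact (h ht.1).max (h' ht.2)

/-- A strict lower bound of the value of an expression holds on a product of neighbourhoods. -/
theorem exists_bump_lt_value {e : E} {f : F} (he : 0 ≤ e) (hf : 0 ≤ f) {φ₀ : E →ₗ[ℝ] ℝ}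
    {ψ₀ : F →ₗ[ℝ] ℝ} (hφ₀ : IsUnitHom e φ₀) (hψ₀ : IsUnitHom f ψ₀) {t : FremlinTerm E F}
    (ht : t.Dominated e f) {c : ℝ} (hc : c < t.value φ₀ ψ₀) :
    ∃ (a : E) (b : F), (0 ≤ a ∧ a ∈ dominated e ∧ 0 < φ₀ a) ∧ (0 ≤ b ∧ b ∈ dominated f ∧ 0 < ψ₀ b) ∧
      ∀ φ ψ, IsUnitHom e φ → IsUnitHom f ψ → 0 < φ a → 0 < ψ b → c < t.value φ ψ := by
  have h := (tendsto_value_bumpFilter he hf hφ₀ hψ₀ ht).eventually (lt_mem_nhds hc)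
  obtain ⟨s, hs, s', hs', hsub⟩ := Filter.mem_prod_iff.1 h
  obtain ⟨a, h1, h2, h3, ha⟩ := (mem_bumpFilter he hφ₀).1 hs
  obtain ⟨b, h4, h5, h6, hb⟩ := (mem_bumpFilter hf hψ₀).1 hs'
  exact ⟨a, b, ⟨h1, h2, h3⟩, ⟨h4, h5, h6⟩, fun φ ψ hφ hψ h7 h8 =>
    hsub (Set.mk_mem_prod (ha φ hφ h7) (hb ψ hψ h8))⟩

/-- Elementary tensors are order dense in the Fremlin tensor product. -/
theorem FremlinTensor.exists_tmul_le_smul_abs {z : FremlinTensor E F} (hz : z ≠ 0) :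
    ∃ (a : E) (b : F) (c : ℝ), 0 ≤ a ∧ 0 ≤ b ∧ a ≠ 0 ∧ b ≠ 0 ∧ tmul a b ≤ |c • z| := by
  obtain ⟨t, rfl⟩ := z.exists_ofTerm
  obtain ⟨e, f, he, hf, ht⟩ := t.exists_dominated
  -- A formal expression for the absolute value of `t`.
  let u : FremlinTerm E F := .sup t (.smul (-1) t)
  have hu : u.Dominated e f := ⟨ht, ht⟩
  have hu0 : ∀ φ ψ, 0 ≤ u.value φ ψ := fun φ ψ => by
    have : u.value φ ψ = |t.value φ ψ| := by
      simp [u, FremlinTerm.value, abs]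
    rw [this]
    exact abs_nonneg _
  obtain ⟨φ₀, ψ₀, hφ₀, hψ₀, hpos⟩ : ∃ φ ψ, IsUnitHom e φ ∧ IsUnitHom f ψ ∧ 0 < u.value φ ψ := by
    by_contra! hne
    have h0 : |ofTerm t| ≤ 0 :=
      ofTerm_le_ofTerm he hf (s := u) (t := .zero) hu trivial fun φ ψ hφ hψ => hne φ ψ hφ hψ
    exact hz (le_antisymm ((le_abs_self _).trans h0) (neg_nonpos.1 ((neg_le_abs _).trans h0)))
  obtain ⟨a, b, ⟨ha, hae, ha0⟩, ⟨hb, hbf, hb0⟩, hab⟩ :=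
    exists_bump_lt_value he hf hφ₀ hψ₀ hu (half_lt_self hpos)
  obtain ⟨r, hr, har⟩ := id hae
  obtain ⟨r', hr', hbr⟩ := id hbf
  set δ := u.value φ₀ ψ₀ / 2 with hδ
  have hδ0 : 0 < δ := half_pos hpos
  -- Everywhere `φ a * ψ b ≤ r * r'`, and where this product is nonzero the value of `u` exceeds
  -- `δ`.
  refine ⟨a, b, r * r' / δ, ha, hb, by rintro rfl; simp at ha0, by rintro rfl; simp at hb0, ?_⟩
  have hc : 0 ≤ r * r' / δ := by positivity
  rw [abs_real_smul, abs_of_nonneg hc]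
  refine ofTerm_le_ofTerm he hf (s := .tmul a b) (t := .smul (r * r' / δ) u) ⟨hae, hbf⟩ hu
    fun φ ψ hφ hψ => ?_
  change φ a * ψ b ≤ r * r' / δ * u.value φ ψ
  have h1 := hφ.nonneg hae ha
  have h2 := hψ.nonneg hbf hb
  rcases h1.eq_or_lt with h1' | h1'
  · rw [← h1', zero_mul]; exact mul_nonneg hc (hu0 φ ψ)
  rcases h2.eq_or_lt with h2' | h2'
  · rw [← h2', mul_zero]; exact mul_nonneg hc (hu0 φ ψ)
  calc φ a * ψ b ≤ r * r' :=
        mul_le_mul ((le_abs_self _).trans (hφ.abs_le_of_abs_le he hr har))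
          ((le_abs_self _).trans (hψ.abs_le_of_abs_le hf hr' hbr)) h2 hr
    _ = r * r' / δ * δ := (div_mul_cancel₀ _ hδ0.ne').symm
    _ ≤ _ := mul_le_mul_of_nonneg_left (hab φ ψ hφ hψ h1' h2').le hc

end TermValue

/-! ### The bimorphism given by pairs of real lattice homomorphisms of large principal ideals -/

section Germ

variable {E : Type u} {F : Type v}
  [AddCommGroup E] [Lattice E] [IsOrderedAddMonoid E] [Module ℝ E] [IsOrderedModule ℝ E]
  [AddCommGroup F] [Lattice F] [IsOrderedAddMonoid F] [Module ℝ F] [IsOrderedModule ℝ F]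

variable (E F) in
/-- Units `(e, f)` together with functionals `(φ, ψ)`. -/
abbrev PairIndex : Type (max u v) := (E × F) × (E →ₗ[ℝ] ℝ) × (F →ₗ[ℝ] ℝ)

variable (E F) in
/-- The filter of large units `(e, f)`, where `φ` and `ψ` are real lattice homomorphisms of the
ideals generated by `e` and `f`. -/
def pairFilter : Filter (PairIndex E F) :=
  Filter.comap Prod.fst Filter.atTop ⊓
    Filter.principal {i | IsUnitHom i.1.1 i.2.1 ∧ IsUnitHom i.1.2 i.2.2}

theorem eventually_pairFilter {p : PairIndex E F → Prop} :
    (∀ᶠ i in pairFilter E F, p i) ↔ ∃ (e : E) (f : F), ∀ e' f', e ≤ e' → f ≤ f' →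
      ∀ φ ψ, IsUnitHom e' φ → IsUnitHom f' ψ → p ((e', f'), φ, ψ) := by
  rw [pairFilter, Filter.eventually_inf_principal, Filter.eventually_comap,
    Filter.eventually_atTop]
  constructor
  · rintro ⟨⟨e, f⟩, h⟩
    exact ⟨e, f, fun e' f' he hf φ ψ hφ hψ => h (e', f') ⟨he, hf⟩ _ rfl ⟨hφ, hψ⟩⟩
  · rintro ⟨e, f, h⟩
    refine ⟨(e, f), ?_⟩
    rintro ⟨e', f'⟩ ⟨he, hf⟩ ⟨_, φ, ψ⟩ rfl ⟨hφ, hψ⟩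
    exact h e' f' he hf φ ψ hφ hψ

/-- A formal expression, as a germ of functions of pairs of real lattice homomorphisms. -/
def FremlinTerm.germ (t : FremlinTerm E F) : (pairFilter E F).Germ ℝ :=
  ((fun i => t.value i.2.1 i.2.2 : PairIndex E F → ℝ) : (pairFilter E F).Germ ℝ)

theorem FremlinTerm.germ_le_germ {s t : FremlinTerm E F} : s.germ ≤ t.germ ↔
    ∃ (e : E) (f : F), ∀ e' f', e ≤ e' → f ≤ f' →
      ∀ φ ψ, IsUnitHom e' φ → IsUnitHom f' ψ → s.value φ ψ ≤ t.value φ ψ :=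
  Filter.Germ.coe_le.trans eventually_pairFilter

/-- A homomorphism of the small ideal need not extend to the larger one. Instead one takes a
homomorphism of the larger ideal that is positive at the bump `a`; as `a` is below a multiple of
`e`, it is positive at `e` and can be rescaled there. -/
theorem IsUnitHom.exists_normalize (hE : IsArchimedeanLattice E) {e e' a : E} (he : 0 ≤ e)
    (hee' : e ≤ e') (ha : 0 ≤ a) (hae : a ∈ dominated e) (ha0 : a ≠ 0) :
    ∃ (φ : E →ₗ[ℝ] ℝ) (c : ℝ), 0 < c ∧ IsUnitHom e φ ∧ IsUnitHom e' (c • φ) ∧ 0 < φ a := by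
  obtain ⟨φ, hφ, hpos⟩ := hE.exists_isUnitHom (he.trans hee') (dominated_mono hee' hae)
    fun h => ha0 (le_antisymm h ha)
  have hdom := mem_dominated_self he
  obtain ⟨r, hr, har⟩ := id hae
  rw [abs_of_nonneg ha] at har
  have hle := hφ.mono (dominated_mono hee' hae)
    (Submodule.smul_mem _ r (dominated_mono hee' hdom)) har
  rw [map_smul, smul_eq_mul] at hle
  have hc : 0 < φ e := pos_of_mul_pos_right (hpos.trans_le hle) hr
  refine ⟨(φ e)⁻¹ • φ, φ e, hc, ⟨inv_mul_cancel₀ hc.ne', fun x hx => ?_⟩, ?_,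
    mul_pos (inv_pos.2 hc) hpos⟩
  · rw [LinearMap.smul_apply, LinearMap.smul_apply, hφ.map_abs x (dominated_mono hee' hx),
      smul_eq_mul, smul_eq_mul, abs_mul, abs_of_pos (inv_pos.2 hc)]
  · rwa [smul_smul, mul_inv_cancel₀ hc.ne', one_smul]

/-- An inequality which holds for all large units holds for all units dominating the expressions. -/
theorem FremlinTerm.value_le_of_germ_le (hE : IsArchimedeanLattice E) (hF : IsArchimedeanLattice F)
    {s t : FremlinTerm E F} (h : s.germ ≤ t.germ) {e : E} {f : F} (he : 0 ≤ e) (hf : 0 ≤ f)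
    (hs : s.Dominated e f) (ht : t.Dominated e f) {φ : E →ₗ[ℝ] ℝ} {ψ : F →ₗ[ℝ] ℝ}
    (hφ : IsUnitHom e φ) (hψ : IsUnitHom f ψ) : s.value φ ψ ≤ t.value φ ψ := by
  by_contra! hlt
  let u : FremlinTerm E F := .add s (.smul (-1) t)
  have hu : ∀ φ ψ, u.value φ ψ = s.value φ ψ - t.value φ ψ := fun φ ψ => by
    simp only [u, value]; ring
  -- A strict failure at `(φ, ψ)` persists on a product of bumps, and each bump is also met by
  -- functionals coming from the larger units.
  obtain ⟨a, b, ⟨ha, hae, ha0⟩, ⟨hb, hbf, hb0⟩, hab⟩ :=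
    exists_bump_lt_value he hf hφ hψ (t := u) ⟨hs, ht⟩ (c := 0) (by rw [hu]; exact sub_pos.2 hlt)
  obtain ⟨e', f', hef⟩ := germ_le_germ.1 h
  obtain ⟨φ', c, hc, hφ', hcφ', ha'⟩ := IsUnitHom.exists_normalize hE he
    (le_sup_left : e ≤ e ⊔ e') ha hae (by rintro rfl; simp at ha0)
  obtain ⟨ψ', d, hd, hψ', hdψ', hb'⟩ := IsUnitHom.exists_normalize hF hf
    (le_sup_left : f ≤ f ⊔ f') hb hbf (by rintro rfl; simp at hb0)
  have h1 := hef _ _ le_sup_right le_sup_right _ _ hcφ' hdψ'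
  rw [value_smul_smul hc.le hd.le, value_smul_smul hc.le hd.le] at h1
  have h2 := le_of_mul_le_mul_left h1 (mul_pos hc hd)
  have h3 := hab φ' ψ' hφ' hψ' ha' hb'
  rw [hu] at h3
  linarith

variable (E F) in
/-- The germs of formal expressions. -/
def termGerms : Submodule ℝ ((pairFilter E F).Germ ℝ) where
  carrier := Set.range FremlinTerm.germ
  zero_mem' := ⟨.zero, rfl⟩
  add_mem' := by
    rintro _ _ ⟨s, rfl⟩ ⟨t, rfl⟩
    exact ⟨.add s t, rfl⟩
  smul_mem' := by
    rintro c _ ⟨t, rfl⟩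
    exact ⟨.smul c t, rfl⟩

instance : Lattice (termGerms E F) :=
  Subtype.lattice
    (by
      rintro _ _ ⟨s, rfl⟩ ⟨t, rfl⟩
      exact ⟨.sup s t, rfl⟩)
    (by
      rintro _ _ ⟨s, rfl⟩ ⟨t, rfl⟩
      refine ⟨.smul (-1) (.sup (.smul (-1) s) (.smul (-1) t)), ?_⟩
      refine congrArg (fun g : PairIndex E F → ℝ => (g : (pairFilter E F).Germ ℝ)) ?_
      funext i
      simp [FremlinTerm.value, max_neg_neg])

instance : IsOrderedAddMonoid (termGerms E F) where
  add_le_add_left _ _ h c := add_le_add_left (α := (pairFilter E F).Germ ℝ) h c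

instance : IsOrderedModule ℝ (termGerms E F) where
  smul_le_smul_of_nonneg_left c hc := by
    rintro ⟨_, s, rfl⟩ ⟨_, t, rfl⟩ h
    have h' : ∀ᶠ i in pairFilter E F, s.value i.2.1 i.2.2 ≤ t.value i.2.1 i.2.2 := h
    exact h'.mono fun i hi => mul_le_mul_of_nonneg_left hi hc
  smul_le_smul_of_nonneg_right := by
    rintro ⟨_, t, rfl⟩ ht c d h
    have h' : ∀ᶠ i in pairFilter E F, 0 ≤ t.value i.2.1 i.2.2 := ht
    exact h'.mono fun i hi => mul_le_mul_of_nonneg_right h hi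

/-- Each inequality `n • s ≤ t` of germs comes with its own threshold units.
`FremlinTerm.value_le_of_germ_le` brings them all down to any common dominating units, where the
Archimedean property of `ℝ` applies. -/
theorem isArchimedeanLattice_termGerms (hE : IsArchimedeanLattice E)
    (hF : IsArchimedeanLattice F) : IsArchimedeanLattice (termGerms E F) := by
  rintro ⟨_, s, rfl⟩ ⟨_, t, rfl⟩ h
  have hn : ∀ n : ℕ, (FremlinTerm.smul n s).germ ≤ t.germ := fun n => by
    have := h n
    rw [← Nat.cast_smul_eq_nsmul ℝ] at this
    exact this
  obtain ⟨e, f, he, hf, hst⟩ := (FremlinTerm.add s t).exists_dominated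
  refine FremlinTerm.germ_le_germ (s := s) (t := .zero).2 ⟨e, f, fun e' f' he' hf' φ ψ hφ hψ => ?_⟩
  change s.value φ ψ ≤ 0
  have hs := FremlinTerm.Dominated.mono he' hf' hst.1
  have ht := FremlinTerm.Dominated.mono he' hf' hst.2
  by_contra! hpos
  obtain ⟨n, hlt⟩ := exists_nat_gt (t.value φ ψ / s.value φ ψ)
  have h1 := FremlinTerm.value_le_of_germ_le hE hF (hn n) (he.trans he') (hf.trans hf') hs ht hφ hψ
  rw [div_lt_iff₀ hpos] at hlt
  exact hlt.not_ge h1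

variable (E F) in
/-- The bilinear map sending `(x, y)` to the germ of `(φ, ψ) ↦ φ x * ψ y`. -/
def germTmul : E →ₗ[ℝ] F →ₗ[ℝ] termGerms E F :=
  LinearMap.mk₂ ℝ (fun x y => ⟨(FremlinTerm.tmul x y).germ, _, rfl⟩)
    (fun x x' y => Subtype.ext <| congrArg (fun g : PairIndex E F → ℝ => (g : (pairFilter E F).Germ ℝ))
      (funext fun i => by simp [FremlinTerm.value, add_mul]))
    (fun c x y => Subtype.ext <| congrArg (fun g : PairIndex E F → ℝ => (g : (pairFilter E F).Germ ℝ))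
      (funext fun i => by simp [FremlinTerm.value, mul_assoc]))
    (fun x y y' => Subtype.ext <| congrArg (fun g : PairIndex E F → ℝ => (g : (pairFilter E F).Germ ℝ))
      (funext fun i => by simp [FremlinTerm.value, mul_add]))
    (fun c x y => Subtype.ext <| congrArg (fun g : PairIndex E F → ℝ => (g : (pairFilter E F).Germ ℝ))
      (funext fun i => by simp [FremlinTerm.value, mul_left_comm]))

/-- The functionals respect suprema only on their ideals; the identities hold once the units
dominate the vectors involved, which is enough for germs. -/
theorem isLatticeBimorphism_germTmul : IsLatticeBimorphism (germTmul E F) where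
  map_sup_right x hx y y' := Subtype.ext <| Filter.Germ.coe_eq.2 <| eventually_pairFilter.2
    ⟨x, |y| ⊔ |y'|, fun e f he hf φ ψ hφ hψ => by
      have hy := mem_dominated_of_abs_le (le_sup_left.trans hf)
      have hy' := mem_dominated_of_abs_le (le_sup_right.trans hf)
      have hx' := hφ.nonneg (mem_dominated_of_abs_le ((abs_of_nonneg hx).trans_le he)) hx
      change φ x * ψ (y ⊔ y') = (φ x * ψ y) ⊔ (φ x * ψ y')
      rw [hψ.map_sup hy hy', mul_max_of_nonneg _ _ hx']⟩
  map_sup_left y hy x x' := Subtype.ext <| Filter.Germ.coe_eq.2 <| eventually_pairFilter.2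
    ⟨|x| ⊔ |x'|, y, fun e f he hf φ ψ hφ hψ => by
      have hx := mem_dominated_of_abs_le (le_sup_left.trans he)
      have hx' := mem_dominated_of_abs_le (le_sup_right.trans he)
      have hy' := hψ.nonneg (mem_dominated_of_abs_le ((abs_of_nonneg hy).trans_le hf)) hy
      change φ (x ⊔ x') * ψ y = (φ x * ψ y) ⊔ (φ x' * ψ y)
      rw [hφ.map_sup hx hx', max_mul_of_nonneg _ _ hy']⟩

variable (E F) in
/-- The bimorphism of `E × F` into germs of functions of pairs of real lattice homomorphisms. -/
def germBimorphism (hE : IsArchimedeanLattice E) (hF : IsArchimedeanLattice F) :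
    ArchBimorphism E F where
  G := termGerms E F
  archimedean := isArchimedeanLattice_termGerms hE hF
  Φ := germTmul E F
  isLatticeBimorphism := isLatticeBimorphism_germTmul

theorem eval_germBimorphism (hE : IsArchimedeanLattice E) (hF : IsArchimedeanLattice F)
    (t : FremlinTerm E F) : t.eval (germBimorphism E F hE hF) = ⟨t.germ, t, rfl⟩ := by
  induction t with
  | tmul x y => rfl
  | zero => rfl
  | add s t h h' => exact (congrArg₂ (· + ·) h h' :)
  | smul c t h => exact (congrArg (c • ·) h :)
  | sup s t h h' => exact (congrArg₂ (· ⊔ ·) h h' :)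

/-- An inequality in the Fremlin tensor product of Archimedean vector lattices holds for the values
under all pairs of real lattice homomorphisms of dominating principal ideals. -/
theorem FremlinTensor.value_le_of_ofTerm_le (hE : IsArchimedeanLattice E)
    (hF : IsArchimedeanLattice F) {s t : FremlinTerm E F} (h : ofTerm s ≤ ofTerm t)
    {e : E} {f : F} (he : 0 ≤ e) (hf : 0 ≤ f)
    (hs : s.Dominated e f) (ht : t.Dominated e f) {φ : E →ₗ[ℝ] ℝ} {ψ : F →ₗ[ℝ] ℝ}
    (hφ : IsUnitHom e φ) (hψ : IsUnitHom f ψ) : s.value φ ψ ≤ t.value φ ψ := by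
  have h1 := h (germBimorphism E F hE hF)
  rw [eval_ofTerm, eval_ofTerm, eval_germBimorphism, eval_germBimorphism] at h1
  exact FremlinTerm.value_le_of_germ_le hE hF h1 he hf hs ht hφ hψ

end Germ

/-! ### Solid hulls and the topology -/

section Solid

variable {G : Type*} [AddCommGroup G] [Lattice G] [IsOrderedAddMonoid G] [Module ℝ G]
  [IsOrderedModule ℝ G]

/-- The Riesz decomposition property. -/
theorem exists_add_eq_of_abs_le_add {b p q : G} (hp : 0 ≤ p) (hq : 0 ≤ q) (h : |b| ≤ p + q) :
    ∃ b₁ b₂ : G, b = b₁ + b₂ ∧ |b₁| ≤ p ∧ |b₂| ≤ q := by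
  obtain ⟨h1, h2⟩ := abs_le'.1 h
  -- The first summand is `b` truncated to the order interval from `-p` to `p`.
  refine ⟨(b ⊓ p) ⊔ -p, b - ((b ⊓ p) ⊔ -p), (add_sub_cancel _ _).symm, ?_, ?_⟩
  · refine abs_le'.2 ⟨sup_le inf_le_right ((neg_nonpos.2 hp).trans hp), ?_⟩
    exact neg_le.1 le_sup_right
  · refine abs_le'.2 ⟨?_, ?_⟩
    · rw [sub_le_iff_le_add', ← sub_le_iff_le_add]
      refine le_sup_of_le_left (le_inf (sub_le_self b hq) ?_)
      rwa [sub_le_iff_le_add]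
    · rw [neg_sub, sub_le_iff_le_add]
      refine sup_le (inf_le_left.trans (le_add_of_nonneg_left hq)) ?_
      rw [neg_le_iff_add_nonneg, add_comm]
      have := neg_le_iff_add_nonneg.1 h2
      refine this.trans_eq ?_
      abel

theorem LatticeOrderedAddCommGroup.IsSolid.balanced {A : Set G} (hA : IsSolid A) : Balanced ℝ A := by
  refine balanced_iff_smul_mem.2 fun r hr a ha => hA ha ?_
  rw [abs_real_smul]
  have := smul_le_smul_of_nonneg_right (show |r| ≤ 1 from hr) (abs_nonneg a)
  rwa [one_smul] at this

/-- The convex balanced hull of a solid set is solid. -/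
theorem LatticeOrderedAddCommGroup.IsSolid.absConvexHull {A : Set G} (hA : IsSolid A) :
    IsSolid (absConvexHull ℝ A) := by
  -- The elements that bring everything below them in absolute value into the hull form an
  -- absolutely convex set containing `A`; Riesz decomposition gives its convexity.
  have key : _root_.absConvexHull ℝ A ⊆
      {a | ∀ b, |b| ≤ |a| → b ∈ _root_.absConvexHull ℝ A} := by
    refine absConvexHull_min (fun a ha b hb => subset_absConvexHull (hA ha hb)) ⟨?_, ?_⟩
    · refine balanced_iff_smul_mem.2 fun r hr a ha b hb => ha b (hb.trans ?_)
      rw [abs_real_smul]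
      have := smul_le_smul_of_nonneg_right (show |r| ≤ 1 from hr) (abs_nonneg a)
      rwa [one_smul] at this
    · refine convex_iff_forall_pos.2 fun a ha a' ha' s t hs ht hst b hb => ?_
      have hle : |b| ≤ s • |a| + t • |a'| := by
        refine hb.trans ((abs_add_le _ _).trans_eq ?_)
        rw [abs_real_smul, abs_real_smul, abs_of_pos hs, abs_of_pos ht]
      obtain ⟨b₁, b₂, rfl, h1, h2⟩ := exists_add_eq_of_abs_le_add
        (smul_nonneg hs.le (abs_nonneg a)) (smul_nonneg ht.le (abs_nonneg a')) hle
      have mem : ∀ (r : ℝ) (c d : G), 0 < r → |d| ≤ r • |c| → |r⁻¹ • d| ≤ |c| := by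
        intro r c d hr h
        rwa [abs_real_smul, abs_of_pos (inv_pos.2 hr), inv_smul_le_iff_of_pos hr]
      have := convex_absConvexHull (ha _ (mem s a b₁ hs h1)) (ha' _ (mem t a' b₂ ht h2)) hs.le ht.le hst
      rwa [smul_inv_smul₀ hs.ne', smul_inv_smul₀ ht.ne'] at this
  exact fun a ha b hb => key ha b hb

variable [TopologicalSpace G] [LocallyConvexSolid G]

theorem LocallyConvexSolid.exists_notMem [T2Space G] {x : G} (hx : x ≠ 0) :
    ∃ U : Set G, IsConvexSolidNhd U ∧ x ∉ U := by
  obtain ⟨U, hU, hsub⟩ := (LocallyConvexSolid.hasBasis_zero (E := G)).mem_iff.1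
    (isOpen_compl_singleton.mem_nhds (Ne.symm hx))
  exact ⟨U, hU, fun h => hsub h rfl⟩

variable (G) in
/-- A Hausdorff locally convex-solid vector lattice is Archimedean. -/
theorem LocallyConvexSolid.isArchimedeanLattice [T2Space G] : IsArchimedeanLattice G := by
  intro x y h
  by_contra hx
  have hx0 : x⁺ ≠ 0 := fun h0 => hx (posPart_eq_zero.1 h0)
  obtain ⟨U, hU, hxU⟩ := LocallyConvexSolid.exists_notMem hx0
  -- For positive `n`, `x⁺ ≤ n⁻¹ • y⁺`, and the right side tends to zero, so solidity would force
  -- `x⁺` into `U`.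
  have htend : Filter.Tendsto (fun n : ℕ => ((n : ℝ)⁻¹) • y⁺) Filter.atTop (𝓝 (0 : G)) := by
    have := (tendsto_inv_atTop_nhds_zero_nat (𝕜 := ℝ)).smul_const y⁺
    rwa [zero_smul] at this
  obtain ⟨n, hn, hn0⟩ := ((htend.eventually hU.1).and (Filter.eventually_gt_atTop 0)).exists
  have hn0' : (0 : ℝ) < n := by exact_mod_cast hn0
  refine hxU (hU.2.2 hn ?_)
  have hy := smul_nonneg (inv_nonneg.2 hn0'.le) (posPart_nonneg y)
  rw [abs_of_nonneg (posPart_nonneg x), abs_of_nonneg hy]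
  refine sup_le ?_ hy
  rw [le_inv_smul_iff_of_pos hn0', Nat.cast_smul_eq_nsmul]
  exact (h n).trans (le_posPart y)

end Solid

/-! ### Separation of points in the tensor product -/

section Hausdorff

variable {E : Type u} {F : Type v}
  [AddCommGroup E] [Lattice E] [IsOrderedAddMonoid E] [Module ℝ E] [IsOrderedModule ℝ E]
  [AddCommGroup F] [Lattice F] [IsOrderedAddMonoid F] [Module ℝ F] [IsOrderedModule ℝ F]

namespace FremlinTensor

theorem isSolid_hull (U : Set E) (V : Set F) : IsSolid (hull U V) :=
  (isSolid_solidClosure _).absConvexHull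

/-- A solid set is balanced, so its convex hull already contains the convex balanced hull. The
factors are made positive through `|u ⊗ v| ≤ |u| ⊗ |v|`, and solidity keeps them in `U` and `V`. -/
theorem exists_abs_le_sum_of_mem_hull {U : Set E} {V : Set F} (hU : IsSolid U) (hV : IsSolid V)
    {z : FremlinTensor E F} (hz : z ∈ hull U V) :
    ∃ (ι : Type) (_ : Fintype ι) (w : ι → ℝ) (u : ι → E) (v : ι → F),
      (∀ i, 0 ≤ w i) ∧ ∑ i, w i = 1 ∧ (∀ i, 0 ≤ u i ∧ u i ∈ U) ∧ (∀ i, 0 ≤ v i ∧ v i ∈ V) ∧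
      |z| ≤ ∑ i, w i • tmul (u i) (v i) := by
  have hsub : hull U V ⊆ convexHull ℝ (solidClosure (Set.image2 tmul U V)) :=
    absConvexHull_min (subset_convexHull ℝ _)
      ⟨((isSolid_solidClosure _).balanced).convexHull, convex_convexHull ℝ _⟩
  obtain ⟨ι, _, w, z', hw, hw1, hz', rfl⟩ := mem_convexHull_iff_exists_fintype.1 (hsub hz)
  have hz'' : ∀ i, ∃ u v, u ∈ U ∧ v ∈ V ∧ |z' i| ≤ |tmul u v| := fun i => by
    obtain ⟨_, ⟨u, hu, v, hv, rfl⟩, h⟩ := hz' i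
    exact ⟨u, v, hu, hv, h⟩
  choose u v hu hv h using hz''
  refine ⟨ι, inferInstance, w, fun i => |u i|, fun i => |v i|, hw, hw1,
    fun i => ⟨abs_nonneg _, hU (hu i) (abs_abs _).le⟩,
    fun i => ⟨abs_nonneg _, hV (hv i) (abs_abs _).le⟩, ?_⟩
  refine (Finset.le_sum_of_subadditive (fun x : FremlinTensor E F => |x|) abs_zero.le
    abs_add_le _ _).trans (Finset.sum_le_sum fun i _ => ?_)
  rw [abs_real_smul, abs_of_nonneg (hw i)]
  exact smul_le_smul_of_nonneg_left ((h i).trans (abs_tmul_le _ _)) (hw i)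

/-- The order tests apply to formal expressions; this supplies one for a finite sum, along with its
units and values. -/
theorem exists_ofTerm_eq_sum {ι : Type*} (s : Finset ι) (w : ι → ℝ) (u : ι → E) (v : ι → F) :
    ∃ t : FremlinTerm E F, ofTerm t = ∑ i ∈ s, w i • tmul (u i) (v i) ∧
      (∀ e f, (∀ i ∈ s, u i ∈ dominated e) → (∀ i ∈ s, v i ∈ dominated f) → t.Dominated e f) ∧
      ∀ φ ψ, t.value φ ψ = ∑ i ∈ s, w i * (φ (u i) * ψ (v i)) := by
  classical
  induction s using Finset.induction_on with
  | empty => exact ⟨.zero, by rw [Finset.sum_empty]; rfl, fun _ _ _ _ => trivial, fun _ _ => rfl⟩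
  | insert a s ha ih =>
    obtain ⟨t, h1, h2, h3⟩ := ih
    refine ⟨.add (.smul (w a) (.tmul (u a) (v a))) t, ?_, fun e f hu hv => ?_, fun φ ψ => ?_⟩
    · rw [Finset.sum_insert ha, ← h1]
      rfl
    · rw [Finset.forall_mem_insert] at hu hv
      exact ⟨⟨hu.1, hv.1⟩, h2 e f hu.2 hv.2⟩
    · rw [Finset.sum_insert ha, ← h3]
      rfl

/-- A positive elementary tensor in the convex balanced solid hull of `U ⊗ V` has a factor in `U` or
in `V`. -/
theorem mem_or_mem_of_tmul_mem_hull (hE : IsArchimedeanLattice E) (hF : IsArchimedeanLattice F)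
    {U : Set E} {V : Set F} (hU : Convex ℝ U) (hUs : IsSolid U) (hV : Convex ℝ V) (hVs : IsSolid V)
    {a : E} {b : F} (ha : 0 ≤ a) (hb : 0 ≤ b) (hab : tmul a b ∈ hull U V) : a ∈ U ∨ b ∈ V := by
  obtain ⟨ι, _, w, u, v, hw, hw1, hu, hv, hle⟩ := exists_abs_le_sum_of_mem_hull hUs hVs hab
  have hι : Nonempty ι := by
    by_contra hne
    rw [not_nonempty_iff] at hne
    simp at hw1
  obtain ⟨t, ht, htd, htv⟩ := exists_ofTerm_eq_sum Finset.univ w u v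
  rw [← ht] at hle
  have hle' : ofTerm (.tmul a b) ≤ ofTerm t := (le_abs_self _).trans hle
  set e := a + ∑ i, u i with he
  set f := b + ∑ i, v i with hf
  have hu0 : 0 ≤ ∑ i, u i := Finset.sum_nonneg fun i _ => (hu i).1
  have hv0 : 0 ≤ ∑ i, v i := Finset.sum_nonneg fun i _ => (hv i).1
  have he0 : 0 ≤ e := add_nonneg ha hu0
  have hf0 : 0 ≤ f := add_nonneg hb hv0
  have hae : a ∈ dominated e :=
    mem_dominated_of_abs_le ((abs_of_nonneg ha).trans_le (le_add_of_nonneg_right hu0))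
  have hbf : b ∈ dominated f :=
    mem_dominated_of_abs_le ((abs_of_nonneg hb).trans_le (le_add_of_nonneg_right hv0))
  have hue : ∀ i, u i ∈ dominated e := fun i =>
    mem_dominated_of_abs_le ((abs_of_nonneg (hu i).1).trans_le
      ((Finset.single_le_sum (fun j _ => (hu j).1) (Finset.mem_univ i)).trans
        (le_add_of_nonneg_left ha)))
  have hvf : ∀ i, v i ∈ dominated f := fun i =>
    mem_dominated_of_abs_le ((abs_of_nonneg (hv i).1).trans_le
      ((Finset.single_le_sum (fun j _ => (hv j).1) (Finset.mem_univ i)).trans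
        (le_add_of_nonneg_left hb)))
  by_cases haU : a ∈ U
  · exact Or.inl haU
  refine Or.inr ?_
  -- Otherwise some `ψ` has `ψ b > ∑ i, w i * ψ (v i)`. Applying `ψ` to the second factors gives `ψ
  -- b • a ≤ ∑ i, (w i * ψ (v i)) • u i`; after division by `ψ b` the weights sum to at most `1`, so
  -- `a` would lie in `U`.
  have hbv : b ≤ ∑ i, w i • v i := by
    refine hF.le_of_forall_isUnitHom hf0 hbf
      (Submodule.sum_mem _ fun i _ => Submodule.smul_mem _ _ (hvf i)) fun ψ hψ => ?_
    rw [map_sum]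
    simp only [map_smul, smul_eq_mul]
    by_contra! hlt
    have hψv : ∀ i, 0 ≤ w i * ψ (v i) := fun i => mul_nonneg (hw i) (hψ.nonneg (hvf i) (hv i).1)
    set d := ∑ i, w i * ψ (v i) with hd
    have hd0 : 0 ≤ d := Finset.sum_nonneg fun i _ => hψv i
    have hc0 : 0 < ψ b := hd0.trans_lt hlt
    have hE' : ψ b • a ≤ ∑ i, (w i * ψ (v i)) • u i := by
      refine hE.le_of_forall_isUnitHom he0 (Submodule.smul_mem _ _ hae)
        (Submodule.sum_mem _ fun i _ => Submodule.smul_mem _ _ (hue i)) fun φ hφ => ?_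
      have h := value_le_of_ofTerm_le hE hF hle' he0 hf0 ⟨hae, hbf⟩
        (htd e f (fun i _ => hue i) fun i _ => hvf i) hφ hψ
      rw [htv] at h
      change φ a * ψ b ≤ _ at h
      rw [map_smul, map_sum, smul_eq_mul, mul_comm]
      refine h.trans_eq (Finset.sum_congr rfl fun i _ => ?_)
      rw [map_smul, smul_eq_mul]
      ring
    obtain ⟨i₀⟩ := hι
    have h0U : (0 : E) ∈ U := hUs (hu i₀).2 (by rw [abs_zero]; exact abs_nonneg _)
    have hmem : ∑ i, ((ψ b)⁻¹ * (w i * ψ (v i))) • u i ∈ U := by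
      have hsum : ∑ i, (ψ b)⁻¹ * (w i * ψ (v i)) ≤ 1 := by
        rw [← Finset.mul_sum, ← hd, inv_mul_le_iff₀ hc0, mul_one]
        exact hlt.le
      -- The additional index `none` places the missing weight at `0 ∈ U`.
      have h := hU.sum_mem (t := (Finset.univ : Finset (Option ι)))
        (w := fun o => o.elim (1 - ∑ i, (ψ b)⁻¹ * (w i * ψ (v i)))
          fun i => (ψ b)⁻¹ * (w i * ψ (v i)))
        (z := fun o => o.elim 0 u)
        (by
          rintro (_ | i) -
          · exact sub_nonneg.2 hsum
          · exact mul_nonneg (inv_nonneg.2 hc0.le) (hψv i))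
        (by simp [Fintype.sum_option])
        (by
          rintro (_ | i) -
          · exact h0U
          · exact (hu i).2)
      simpa [Fintype.sum_option] using h
    refine haU (hUs hmem ?_)
    rw [abs_of_nonneg ha]
    refine le_trans ?_ (le_abs_self _)
    simp only [mul_smul (ψ b)⁻¹]
    rwa [← Finset.smul_sum, le_inv_smul_iff_of_pos hc0]
  refine hVs (hV.sum_mem (fun i _ => hw i) hw1 fun i _ => (hv i).2) ?_
  rw [abs_of_nonneg hb]
  exact hbv.trans (le_abs_self _)

variable [TopologicalSpace E] [LocallyConvexSolid E] [TopologicalSpace F] [LocallyConvexSolid F]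

theorem hull_mem_nhds_zero {U : Set E} {V : Set F} (hU : IsConvexSolidNhd U)
    (hV : IsConvexSolidNhd V) : hull U V ∈ 𝓝 (0 : FremlinTensor E F) :=
  (moduleFilterBasis E F).toAddGroupFilterBasis.nhds_zero_hasBasis.mem_of_mem ⟨U, V, hU, hV, rfl⟩

instance : IsTopologicalAddGroup (FremlinTensor E F) :=
  (moduleFilterBasis E F).isTopologicalAddGroup

instance : ContinuousSMul ℝ (FremlinTensor E F) :=
  (moduleFilterBasis E F).continuousSMul

instance : LocallyConvexSolid (FremlinTensor E F) where
  hasBasis_zero := ⟨fun s => by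
    refine ⟨fun hs => ?_, fun ⟨W, hW, hWs⟩ => Filter.mem_of_superset hW.1 hWs⟩
    obtain ⟨_, ⟨U, V, hU, hV, rfl⟩, hsub⟩ :=
      (moduleFilterBasis E F).toAddGroupFilterBasis.nhds_zero_hasBasis.mem_iff.1 hs
    exact ⟨hull U V, ⟨hull_mem_nhds_zero hU hV, convex_absConvexHull, isSolid_hull U V⟩, hsub⟩⟩

instance [T2Space E] [T2Space F] : T2Space (FremlinTensor E F) := by
  refine IsTopologicalAddGroup.t2Space_of_zero_sep fun z hz => ?_
  obtain ⟨a, b, c, ha, hb, ha0, hb0, hle⟩ := exists_tmul_le_smul_abs hz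
  obtain ⟨U, hU, haU⟩ := LocallyConvexSolid.exists_notMem ha0
  obtain ⟨V, hV, hbV⟩ := LocallyConvexSolid.exists_notMem hb0
  -- It is `c • z`, not `z`, that dominates `a ⊗ b`, so the hull is pulled back along multiplication
  -- by `c`.
  refine ⟨(fun x => c • x) ⁻¹' hull U V, (continuous_const_smul c).continuousAt.preimage_mem_nhds
    (by rw [smul_zero]; exact hull_mem_nhds_zero hU hV), fun hmem => ?_⟩
  have hpos := abs_tmul_le a b
  rw [abs_of_nonneg ha, abs_of_nonneg hb] at hpos
  have hab : tmul a b ∈ hull U V := isSolid_hull U V hmem (by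
    rw [abs_of_nonneg ((abs_nonneg _).trans hpos)]
    exact hle)
  rcases mem_or_mem_of_tmul_mem_hull (LocallyConvexSolid.isArchimedeanLattice E)
    (LocallyConvexSolid.isArchimedeanLattice F) hU.2.1 hU.2.2 hV.2.1 hV.2.2 ha hb hab with h | h
  exacts [haU h, hbV h]

end FremlinTensor

end Hausdorff

theorem mainTheorem4 {E : Type u} {F : Type v}
    [AddCommGroup E] [Lattice E] [IsOrderedAddMonoid E] [Module ℝ E] [IsOrderedModule ℝ E]
    [AddCommGroup F] [Lattice F] [IsOrderedAddMonoid F] [Module ℝ F] [IsOrderedModule ℝ F]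
    [TopologicalSpace E] [LocallyConvexSolid E] [T2Space E]
    [TopologicalSpace F] [LocallyConvexSolid F] [T2Space F] :
    LocallyConvexSolid (FremlinTensor E F) ∧ T2Space (FremlinTensor E F) :=
  ⟨inferInstance, inferInstance⟩
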